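/- Conventions. Let $n\ge 0$. Partitions are identified with Young diagrams; $\ell(\lambda)$ is the number of parts and $\varpi_m=(1^m)$. $SST_{2n}(\lambda)$ is the set of semistandard tableaux of shape $\lambda$ with entries in $[1,2n]$, and $SpT_{2n}(\mu)\subseteq SST_{2n}(\mu)$ the set of symplectic ones, i.e. those whose $k$-th entry in the first column is $\ge 2k-1$ for all $k$. Let $u=(2,3,6,7,10,11,\dots)$ and $v=(1,4,5,8,9,12,\dots)$, i.e. $u_k=2k-\frac{1+(-1)^k}2$, $v_k=2k-\frac{1+(-1)^{k+1}}2$. For $\ell(\mu)\le n$ let $S^{H,\mu}$ (resp. $S_{L,-\mu}$) be the tableau of shape $\mu$ with all entries in row $k$ equal to $u_k$ (resp. $v_k$). The $\mathfrak k$-weight of a tableau $T$ is $(T[u_k]-T[v_k])_{k=1}^n$, where $T[a]$ is the number of entries $a$ in $T$. The map $LR^{AII}$. For a column $\mathbf a=(a_1<\dots<a_l)$ define $\mathrm{rem}(\mathbf a)=\emptyset$ if $l\le 1$; $\mathrm{rem}(\mathbf a)=\mathrm{rem}(a_1,\dots,a_{l-2})\cup\{a_{l-1},a_l\}$ if $l\ge2$,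 $a_l$ is even, $a_{l-1}=a_l-1$ and $a_l<2l-|\mathrm{rem}(a_1,\dots,a_{l-2})|-1$; and $\mathrm{rem}(\mathbf a)=\mathrm{rem}(a_1,\dots,a_{l-1})$ otherwise. Let $\mathrm{red}(\mathbf a)$ be $\mathbf a$ with the entries in $\mathrm{rem}(\mathbf a)$ deleted. Let $\mathrm{suc}(T)$ be the result of deleting the first column $\mathbf t$ of $T$ and column inserting (Schensted) the entries of $\mathrm{red}(\mathbf t)$, in increasing order, into the remaining tableau. Then $LR^{AII}(T)=(P^{AII}(T),Q^{AII}(T))$, where $P^{AII}(T)$ is the stable value of $\mathrm{suc}^k(T)$ and $Q^{AII}(T)$ has the entry $k$ in the cells of the shape of $\mathrm{suc}^{k-1}(T)$ outside the shape of $\mathrm{suc}^k(T)$. A tableau $T\in SST_{2n}(\lambda)$ is a $\mathfrak k$-highest (resp. $\mathfrak k$-lowest) weight tableau if $P^{AII}(T)=S^{H,\nu}$ (resp. $S_{L,-\nu}$) for some $\nu$ with $\ell(\nu)\le n$. $Rec_{2n}(\lambda/\mu)$ is the set of recording tableaux obtained from the Littlewood-Richardson-Sundaram tableaux $R$ of shape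 $\lambda/\mu$ (semistandard of shape $\lambda/\mu$ with entries in $[1,2n]$, reverse column word Yamanouchi, weight a partition with $R[2i-1]=R[2i]$ for all $i\ge 1$, and $R(n+i,1)\ge 2i$ for all $i\ge1$ with $n+i\le\ell(\lambda)$) by replacing, for all $k$ and $a$, the $k$-th occurrence of the letter $a$ from the right by $k$. Statement. Let $\mu\subseteq\lambda$ be partitions with $\ell(\mu)\le n$, $l:=\ell(\lambda)\le 2n$, such that $\lambda/\mu$ is a vertical strip, and let $Q\in Rec_{2n}(\lambda/\mu)$ have all its entries on $\lambda/\mu$ equal to $1$. Let $\mathbf r=(r_1<\dots<r_{t_0})$ be the rows in $[1,\ell(\mu)]$ that contain no cell of $\lambda/\mu$, let $\delta_{\mathbf r}$ be its incidence vector, and $\mu'=\mu-\delta_{\mathbf r}$. Then $\mu'$ is a partition and $\lambda=\mu'+\varpi_l$. For a column $a_1<\dots<a_{t_0}$ put $g_1=a_1-2$ if $a_1$ is even and $g_1=a_1-1$ if $a_1$ is odd, and, for $1\le i<t_0$, $$g_{i+1}=\begin{cases}a_{i+1}-a_i-2,& a_i\equiv a_{i+1}\pmod 2,\\ a_{i+1}-a_i-1,&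 a_i\text{ even},\ a_{i+1}\text{ odd},\\ a_{i+1}-a_i-3,& a_i\text{ odd},\ a_{i+1}\text{ even},\ a_{i+1}-a_i\ge3,\\ 0,&\text{otherwise.}\end{cases}$$ Define successively $l_i=\min(g_i,\;l-t_0-l_1-\dots-l_{i-1})$ for $1\le i\le t_0$, and $l_{t_0+1}=l-t_0-\sum_{i\le t_0}l_i$; thus, if $\sum_i g_i\le l-t_0$, one has $l_i=g_i$ for $i\le t_0$ and $l_{t_0+1}=l-t_0-\sum_i g_i$. Let $T_0=(1,2,\dots,l_1)$ and, for $1\le i\le t_0$, $T_i=(a_i,a_i+1,\dots,a_i+l_{i+1})$ if $a_i$ is even and $T_i=(a_i,a_i+2,a_i+3,\dots,a_i+1+l_{i+1})$ if $a_i$ is odd (so $T_i=(a_i)$ if $l_{i+1}=0$). (1) $S^{H,\mu}\in SpT_{2n}(\mu)$ and $S^{H,\mu'}\in SpT_{2n}(\mu')$. For $a_i=u_{r_i}$ the numbers $l_1,\dots,l_{t_0+1}$ are nonnegative even numbers with sum $l-t_0$, the concatenation $T^u_0T^u_1\cdots T^u_{t_0}$ of the $T_i$ is a column in $SST_{2n}(\varpi_l)$,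 and the tableau $(T^u_0T^u_1\cdots T^u_{t_0})S^{H,\mu'}$ with this first column, followed by $S^{H,\mu'}$, lies in $SST_{2n}(\lambda)$, is the unique preimage of $(S^{H,\mu},Q)$ under $LR^{AII}$ in $SST_{2n}(\lambda)$, and is a $\mathfrak k$-highest weight tableau of $\mathfrak k$-weight $\mu$. (2) $S_{L,-\mu}\in SpT_{2n}(\mu)$ and $S_{L,-\mu'}\in SpT_{2n}(\mu')$. For $a_i=v_{r_i}$ the numbers $l_1,\dots,l_{t_0+1}$ are nonnegative even numbers with sum $l-t_0$, the concatenation $T^v_0T^v_1\cdots T^v_{t_0}$ is a column in $SST_{2n}(\varpi_l)$, and the tableau $(T^v_0T^v_1\cdots T^v_{t_0})S_{L,-\mu'}$ lies in $SST_{2n}(\lambda)$, is the unique preimage of $(S_{L,-\mu},Q)$ under $LR^{AII}$ in $SST_{2n}(\lambda)$, and is a $\mathfrak k$-lowest weight tableau of $\mathfrak k$-weight $-\mu$. -/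

import Mathlib

/-!
Partitions are Mathlib's Young diagrams (rows and columns indexed from `0`), so that
`lam.rowLen i` is the part number `i + 1` and `lam.colLen 0` is the length of `lam`.
-/

namespace AII

/-! ### Tableaux -/

/-- Semistandard tableaux of straight shape `lam` with entries in `[1, m]`. -/
def SST (m : ℕ) (lam : YoungDiagram) : Set (SemistandardYoungTableau lam) :=
  {T | ∀ i j, (i, j) ∈ lam → 1 ≤ T i j ∧ T i j ≤ m}

/-- Symplectic tableaux: the first-column entry in row `k` (counted from `1`) is at least
`2 * k - 1`. -/
def SpT (n : ℕ) (mu : YoungDiagram) : Set (SemistandardYoungTableau mu) :=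
  {S | S ∈ SST (2 * n) mu ∧ ∀ i, (i, 0) ∈ mu → 2 * i + 1 ≤ S i 0}

/-- `c` is a column of length `l` with entries in `[1, m]`, read from top to bottom. -/
def IsColumn (m l : ℕ) (c : List ℕ) : Prop :=
  c.length = l ∧ c.Pairwise (· < ·) ∧ ∀ x ∈ c, 1 ≤ x ∧ x ≤ m

/-- `lam / mu` is a vertical strip: at most one cell in each row. -/
def IsVerticalStrip (lam mu : YoungDiagram) : Prop :=
  mu ≤ lam ∧ ∀ i, lam.rowLen i ≤ mu.rowLen i + 1

/-- `T` has first column `c`, and deleting this column leaves `S`. -/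
def IsConcat {lam mu' : YoungDiagram} (T : SemistandardYoungTableau lam)
    (c : List ℕ) (S : SemistandardYoungTableau mu') : Prop :=
  (∀ i, T i 0 = c.getD i 0) ∧ ∀ i j, T i (j + 1) = S i j

/-! ### Littlewood-Richardson-Sundaram tableaux and recording tableaux -/

/-- Semistandard tableaux of skew shape `lam / mu` with entries in `[1, m]` on the cells of
`lam / mu`, extended by `0` to all other cells. -/
def SkewSST (m : ℕ) (lam mu : YoungDiagram) : Set (ℕ → ℕ → ℕ) :=
  {T | (∀ i j, (i, j) ∈ lam → (i, j) ∉ mu → 1 ≤ T i j ∧ T i j ≤ m) ∧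
    (∀ i j, ¬ ((i, j) ∈ lam ∧ (i, j) ∉ mu) → T i j = 0) ∧
    (∀ i j, (i, j) ∉ mu → (i, j + 1) ∈ lam → T i j ≤ T i (j + 1)) ∧
    (∀ i j, (i, j) ∉ mu → (i + 1, j) ∈ lam → T i j < T (i + 1) j)}

/-- Reverse column word: columns from right to left, each read from top to bottom. -/
def revColWord (lam mu : YoungDiagram) (T : ℕ → ℕ → ℕ) : List ℕ :=
  ((List.range (lam.rowLen 0)).reverse).flatMap fun j =>
    ((List.range (lam.colLen j)).filter fun i => (i, j) ∉ mu).map fun i => T i j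

/-- Every prefix has partition weight. -/
def IsYamanouchi (w : List ℕ) : Prop :=
  ∀ k a, 1 ≤ a → (w.take k).count (a + 1) ≤ (w.take k).count a

/-- Number of cells of `lam / mu` filled with `a`. -/
def skewContent (lam mu : YoungDiagram) (T : ℕ → ℕ → ℕ) (a : ℕ) : ℕ :=
  ((lam.cells \ mu.cells).filter fun c => T c.1 c.2 = a).card

/-- The `n`-symplectic Littlewood-Richardson (Littlewood-Richardson-Sundaram) tableaux of shape
`lam / mu`. In the last clause, the row of index `n + i` is row `n + (i + 1)` counted
from `1`. -/
def LRS (n : ℕ) (lam mu : YoungDiagram) : Set (ℕ → ℕ → ℕ) :=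
  {T | T ∈ SkewSST (2 * n) lam mu ∧
    IsYamanouchi (revColWord lam mu T) ∧
    ((∀ a, 1 ≤ a → skewContent lam mu T (a + 1) ≤ skewContent lam mu T a) ∧
      ∀ i, 1 ≤ i → skewContent lam mu T (2 * i - 1) = skewContent lam mu T (2 * i)) ∧
    ∀ i, (n + i, 0) ∈ lam → 2 * (i + 1) ≤ T (n + i) 0}

/-- The relabelling of a Littlewood-Richardson tableau. The first vertical strip peeled off
consists of the rightmost `1`, the rightmost `2`, and so on; the `k`-th strip consists of the
`k`-th `1`, the `k`-th `2`, ... from the right, and its cells get the label `k`. (Equal entries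
lie in different columns.) -/
def diamond (lam mu : YoungDiagram) (T : ℕ → ℕ → ℕ) : ℕ → ℕ → ℕ := fun i j =>
  if (i, j) ∈ lam ∧ (i, j) ∉ mu then
    ((lam.cells \ mu.cells).filter fun c => T c.1 c.2 = T i j ∧ j ≤ c.2).card
  else 0

/-- The recording tableaux of shape `lam / mu`. -/
def recTableaux (n : ℕ) (lam mu : YoungDiagram) : Set (ℕ → ℕ → ℕ) :=
  diamond lam mu '' LRS n lam mu

/-! ### The quantum Littlewood-Richardson map of type AII

The algorithm works on tableaux written as lists of columns, each column a list read from top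
to bottom. -/

/-- The list of columns of a tableau. -/
def cols {lam : YoungDiagram} (T : SemistandardYoungTableau lam) : List (List ℕ) :=
  (List.range (lam.rowLen 0)).map fun j => (List.range (lam.colLen j)).map fun i => T i j

/-- Removable entries of a column `a_1 < ... < a_l`, given in the reversed order
`a_l, ..., a_1`: if `a_l` is even, `a_{l-1} = a_l - 1` and
`a_l < 2 l - |rem (a_1, ..., a_{l-2})| - 1`, then `a_{l-1}` and `a_l` are removable together with
`rem (a_1, ..., a_{l-2})`; otherwise `rem (a_1, ..., a_l) = rem (a_1, ..., a_{l-1})`. -/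
def remRev : List ℕ → List ℕ
  | [] => []
  | [_] => []
  | y :: x :: t =>
    if Even y ∧ y = x + 1 ∧ y + (remRev t).length + 1 < 2 * (t.length + 2) then
      y :: x :: remRev t
    else remRev (x :: t)

/-- The reduction of a column: delete its removable entries. -/
def red (a : List ℕ) : List ℕ :=
  a.filter fun x => x ∉ remRev a.reverse

/-- Schensted insertion of `x` into a column: `x` replaces the smallest entry `≥ x`, which is
bumped out, or is put at the bottom if there is no such entry. -/
def colBump (x : ℕ) : List ℕ → List ℕ × Option ℕ
  | [] => ([x], none)
  | y :: c => if x ≤ y then (x :: c, some y) else (y :: (colBump x c).1, (colBump x c).2)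

/-- Schensted column insertion of `x` into a tableau. -/
def colInsert (x : ℕ) : List (List ℕ) → List (List ℕ)
  | [] => [[x]]
  | c :: T =>
    match colBump x c with
    | (c', none) => c' :: T
    | (c', some y) => c' :: colInsert y T

/-- The (plactic) product of a column and a tableau: the entries of the column are column
inserted one after the other, the smallest one first. -/
def colMul (a : List ℕ) (T : List (List ℕ)) : List (List ℕ) :=
  a.foldl (fun U x => colInsert x U) T

/-- One step of the algorithm: the first column is split off, reduced, and multiplied back. -/
def suc : List (List ℕ) → List (List ℕ)
  | [] => []
  | c :: T => colMul (red c) T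

/-- Number of cells. -/
def size (T : List (List ℕ)) : ℕ := (T.map List.length).sum

/-- The symplectic tableau: the stable value of the iterates of `suc`. (A step either fixes the
tableau or lowers the number of its cells.) -/
def PAII (T : List (List ℕ)) : List (List ℕ) := suc^[size T] T

/-- The cell `(i, j)` belongs to the shape of `T`. -/
def InShape (T : List (List ℕ)) (i j : ℕ) : Prop := i < (T.getD j []).length

open Classical in
/-- The recording tableau: a cell that leaves the shape at step `k` gets the label `k`, all other
cells get `0`. -/
noncomputable def QAII (T : List (List ℕ)) : ℕ → ℕ → ℕ := fun i j =>
  if h : ∃ k, ¬ InShape (suc^[k] T) i j then Nat.find h else 0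

/-- The quantum Littlewood-Richardson map `T ↦ (P(T), Q(T))`. -/
noncomputable def LRAII {lam : YoungDiagram} (T : SemistandardYoungTableau lam) :
    List (List ℕ) × (ℕ → ℕ → ℕ) :=
  (PAII (cols T), QAII (cols T))

/-- The set of preimages in `SST (2 * n) lam` of the pair `(S, Q)` under the quantum
Littlewood-Richardson map. -/
def LRAIIFiber (n : ℕ) (lam : YoungDiagram) {mu : YoungDiagram}
    (S : SemistandardYoungTableau mu) (Q : ℕ → ℕ → ℕ) : Set (SemistandardYoungTableau lam) :=
  {T | T ∈ SST (2 * n) lam ∧ LRAII T = (cols S, Q)}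

/-! ### Highest and lowest weight tableaux -/

/-- `2, 3, 6, 7, 10, 11, ...` for `k = 1, 2, 3, ...` -/
def u (k : ℕ) : ℕ := 2 * k - (if Even k then 1 else 0)

/-- `1, 4, 5, 8, 9, 12, ...` for `k = 1, 2, 3, ...` -/
def v (k : ℕ) : ℕ := 2 * k - (if Odd k then 1 else 0)

theorem u_strictMono : StrictMono fun i => u (i + 1) := by
  refine strictMono_nat_of_lt_succ fun i => ?_
  simp only [u]
  split_ifs <;> omega

theorem v_strictMono : StrictMono fun i => v (i + 1) := by
  refine strictMono_nat_of_lt_succ fun i => ?_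
  simp only [v]
  split_ifs <;> omega

/-- The tableau of shape `mu` all of whose entries in row `i` (counted from `0`) are `f i`. -/
def rowConst (f : ℕ → ℕ) (hf : StrictMono f) (mu : YoungDiagram) :
    SemistandardYoungTableau mu where
  entry i j := if (i, j) ∈ mu then f i else 0
  row_weak' := by
    intro i j1 j2 h hm
    have h1 : (i, j1) ∈ mu := mu.up_left_mem le_rfl h.le hm
    simp [h1, hm]
  col_strict' := by
    intro i1 i2 j h hm
    have h1 : (i1, j) ∈ mu := mu.up_left_mem h.le le_rfl hm
    simpa [h1, hm] using hf h
  zeros' := by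
    intro i j h
    simp [h]

/-- The symplectic highest weight tableau of shape `mu`. -/
def SHigh (mu : YoungDiagram) : SemistandardYoungTableau mu :=
  rowConst (fun i => u (i + 1)) u_strictMono mu

/-- The symplectic lowest weight tableau of shape `mu`. -/
def SLow (mu : YoungDiagram) : SemistandardYoungTableau mu :=
  rowConst (fun i => v (i + 1)) v_strictMono mu

/-- Highest weight tableaux: `P(T)` is a symplectic highest weight tableau. -/
def IsKHighest (n : ℕ) {lam : YoungDiagram} (T : SemistandardYoungTableau lam) : Prop :=
  ∃ nu : YoungDiagram, nu.colLen 0 ≤ n ∧ PAII (cols T) = cols (SHigh nu)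

/-- Lowest weight tableaux: `P(T)` is a symplectic lowest weight tableau. -/
def IsKLowest (n : ℕ) {lam : YoungDiagram} (T : SemistandardYoungTableau lam) : Prop :=
  ∃ nu : YoungDiagram, nu.colLen 0 ≤ n ∧ PAII (cols T) = cols (SLow nu)

/-- Number of occurrences of the letter `a` in `T`. -/
def content {lam : YoungDiagram} (T : SemistandardYoungTableau lam) (a : ℕ) : ℕ :=
  (lam.cells.filter fun c => T c.1 c.2 = a).card

/-- The weight `(T[u_1] - T[v_1], ..., T[u_n] - T[v_n])`. -/
def kWeight (n : ℕ) {lam : YoungDiagram} (T : SemistandardYoungTableau lam) : Fin n → ℤ :=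
  fun k => (content T (u (k + 1)) : ℤ) - (content T (v (k + 1)) : ℤ)

/-! ### Slack data and the explicit column -/

/-- The slack row index vector `r_1 < r_2 < ...` (rows counted from `1`): the rows of `mu`
that contain no cell of the vertical strip `lam / mu`. -/
def slackRows (lam mu : YoungDiagram) : List ℕ :=
  ((List.range (mu.colLen 0)).filter fun i => lam.rowLen i = mu.rowLen i).map (· + 1)

/-- `l_1` as a function of `a_1`. -/
def firstGap (a : ℕ) : ℕ := if Even a then a - 2 else a - 1

/-- `l_{i+1}` as a function of `a = a_i` and `b = a_{i+1}`. -/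
def nextGap (a b : ℕ) : ℕ :=
  if (Even a ∧ Even b) ∨ (¬ Even a ∧ ¬ Even b) then b - a - 2
  else if Even a ∧ ¬ Even b then b - a - 1
  else if 3 ≤ b - a then b - a - 3
  else 0

/-- The numbers `l_1, ..., l_t` attached to a column `a_1 < ... < a_t`. -/
def gaps : List ℕ → List ℕ
  | [] => []
  | a :: t => firstGap a :: List.zipWith nextGap (a :: t) t

/-- `fill [g_1, ..., g_t] m = [l_1, ..., l_t, l_{t+1}]`, where each `l_i` with `i ≤ t` is the
smaller one of `g_i` and `m - l_1 - ... - l_{i-1}`, and `l_{t+1} = m - l_1 - ... - l_t`. -/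
def fill : List ℕ → ℕ → List ℕ
  | [], m => [m]
  | g :: gs, m => min g m :: fill gs (m - min g m)

/-- `T_i` from `a = a_i` and `m = l_{i+1}`: the column `(a, a+1, ..., a+m)` if `a` is even,
`(a, a+2, a+3, ..., a+1+m)` if `a` is odd. -/
def block (a m : ℕ) : List ℕ :=
  if Even a then a :: List.range' (a + 1) m else a :: List.range' (a + 2) m

/-- The column `T_0 T_1 ... T_t` from `a_1, ..., a_t` and `l_1, ..., l_{t+1}`, where
`T_0 = (1, ..., l_1)`. -/
def expandCol (a : List ℕ) : List ℕ → List ℕ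
  | [] => []
  | l1 :: ls => List.range' 1 l1 ++ (List.zipWith block a ls).flatten

end AII

/-!
For a selector `f` of one entry from each pair `{2 * i + 1, 2 * i + 2}`, such as `u` or `v`, the
two halves of the statement are the same theorem, `AII.fiber_rowConst`. It rests on three facts.

*Insertion.* Inserting an increasing sequence `d` into a tableau with columns `t, t', ...` means
inserting `d` into `t`, then the increasing sequence of bumped entries into `t'`, and so on
(`AII.merge`, `AII.colMul_cons`). Hence a column that may stand to the left of a tableau is simply
put there (`AII.colMul_eq_cons`), inserting a part of it gives a semistandard tableau of no larger
shape (`AII.colMul_semistd`), and the insertion can be undone once the shape of the tableau inserted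
into is known (`AII.colMul_injective`). If all entries of the recording tableau are `1`, one step
of the algorithm therefore yields the stable value (`AII.suc_suc_cols`), and a preimage of
`(S, Q)` is determined by the reduction and the length of its first column.

*Reduction.* Read the entries of a column `c` pair by pair, and suppose that `red c` contains no
complete pair. The size condition in the definition of the removable entries then says that a pair
contained in `c` is removed exactly if no earlier pair is disjoint from `c`
(`AII.mem_remLow_iff_emptyPairs`). Thus `red c` is the column `f k`, `k ∈ r`, if and only if `c`
consists of these entries and of complete pairs, off `r`, that precede all the empty pairs off `r`
(`AII.PairPattern`, `AII.PairPattern.red_eq`, `AII.pairPattern_of_red_eq`). Two such columns are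
comparable by inclusion, so there is only one of each length. The explicit column is this one: it
fills the first pairs off `r` (`AII.pairFill`, `AII.expandCol_eq_pairFill`).

*Numbers.* The number `l - r.length` of the cells of the strip is even and at most
`2 * (n - r.length)` because `Q` comes from a Littlewood-Richardson-Sundaram tableau
(`AII.card_strip`); so there are enough pairs in `[1, 2 * n]` to be filled.

Complete pairs do not contribute to the weight, and inserting the column `f k`, `k ∈ r`, into the
tableau with constant rows `f 1, f 2, ...` appends one cell to each row in `r`
(`AII.colMul_map_colsOf`).
-/

namespace AII

/-! ### Column insertion of an increasing sequence -/

/-- Simultaneous column insertion of the increasing sequence `d` into the column `t`: the first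
component is the new column, the second one the sequence of the entries bumped out. -/
def merge : List ℕ → List ℕ → List ℕ × List ℕ
  | d, [] => (d, [])
  | [], t => (t, [])
  | x :: d, y :: t =>
    if x ≤ y then (x :: (merge d t).1, y :: (merge d t).2)
    else (y :: (merge (x :: d) t).1, (merge (x :: d) t).2)

theorem merge_nil_right (d : List ℕ) : merge d [] = (d, []) := by
  cases d <;> rfl

theorem merge_nil_left (t : List ℕ) : merge [] t = (t, []) := by
  cases t <;> rfl

theorem merge_cons_of_le {x y : ℕ} (h : x ≤ y) (d t : List ℕ) :
    merge (x :: d) (y :: t) = (x :: (merge d t).1, y :: (merge d t).2) := by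
  simp [merge, h]

theorem merge_cons_of_forall_lt {y : ℕ} {d : List ℕ} (h : ∀ x ∈ d, y < x) (t : List ℕ) :
    merge d (y :: t) = (y :: (merge d t).1, (merge d t).2) := by
  cases d with
  | nil => simp [merge_nil_left]
  | cons x d => simp [merge, not_le.2 (h x (by simp))]

theorem merge_cons_eq_colBump {x : ℕ} {d : List ℕ} (h : ∀ z ∈ d, x < z) (t : List ℕ) :
    merge (x :: d) t = ((merge d (colBump x t).1).1,
      (colBump x t).2.toList ++ (merge d (colBump x t).1).2) := by
  induction t with
  | nil => simp [colBump, merge_cons_of_forall_lt h, merge_nil_right]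
  | cons y t ih =>
    by_cases hxy : x ≤ y
    · simp [merge_cons_of_le hxy, colBump, hxy, merge_cons_of_forall_lt h]
    · have hy : ∀ z ∈ d, y < z := fun z hz => lt_trans (not_le.1 hxy) (h z hz)
      have hy' : ∀ z ∈ x :: d, y < z := by
        simpa using ⟨not_le.1 hxy, hy⟩
      simp [merge_cons_of_forall_lt hy', colBump, hxy, merge_cons_of_forall_lt hy, ih]

theorem colMul_cons {d : List ℕ} (hd : d.Pairwise (· < ·)) (t : List ℕ) (T : List (List ℕ)) :
    colMul d (t :: T) = (merge d t).1 :: colMul (merge d t).2 T := by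
  induction d generalizing t T with
  | nil => simp [merge_nil_left, colMul]
  | cons x d ih =>
    rw [List.pairwise_cons] at hd
    rw [merge_cons_eq_colBump hd.1]
    have h1 : colMul (x :: d) (t :: T) = colMul d (colInsert x (t :: T)) := rfl
    rw [h1, colInsert]
    rcases hb : colBump x t with ⟨c, _ | y⟩
    · simp [ih hd.2]
    · simp only [ih hd.2, Option.toList_some, List.singleton_append]
      rfl

theorem colMul_nil_right {d : List ℕ} (hd : d.Pairwise (· < ·)) (h0 : d ≠ []) :
    colMul d [] = [d] := by
  cases d with
  | nil => exact absurd rfl h0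
  | cons x d =>
    rw [List.pairwise_cons] at hd
    have h1 : colMul (x :: d) [] = colMul d [[x]] := rfl
    rw [h1, colMul_cons hd.2, merge_cons_of_forall_lt hd.1, merge_nil_right]
    rfl

/-- `ColLE c t`: the columns `c`, `t` may stand next to each other in a semistandard tableau. -/
def ColLE (c t : List ℕ) : Prop :=
  t.length ≤ c.length ∧ ∀ i, i < t.length → c.getD i 0 ≤ t.getD i 0

theorem ColLE.nil (c : List ℕ) : ColLE c [] := by simp [ColLE]

theorem ColLE.refl (c : List ℕ) : ColLE c c := ⟨le_rfl, fun _ _ => le_rfl⟩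

theorem ColLE.trans {a b c : List ℕ} (h : ColLE a b) (h' : ColLE b c) : ColLE a c :=
  ⟨h'.1.trans h.1, fun i hi => (h.2 i (hi.trans_le h'.1)).trans (h'.2 i hi)⟩

theorem colLE_cons {x y : ℕ} {c t : List ℕ} :
    ColLE (x :: c) (y :: t) ↔ x ≤ y ∧ ColLE c t := by
  constructor
  · rintro ⟨h1, h2⟩
    refine ⟨by simpa using h2 0 (by simp), by simpa using h1, fun i hi => ?_⟩
    simpa using h2 (i + 1) (by simpa using hi)
  · rintro ⟨h, h1, h2⟩
    refine ⟨by simpa using h1, fun i hi => ?_⟩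
    cases i with
    | zero => simpa using h
    | succ i => simpa using h2 i (by simpa using hi)

theorem not_colLE_nil_cons {y : ℕ} {t : List ℕ} : ¬ ColLE [] (y :: t) := by
  simp [ColLE]

theorem colLE_cons_self {x : ℕ} {c : List ℕ} (h : (x :: c).Pairwise (· < ·)) :
    ColLE (x :: c) c := by
  induction c generalizing x with
  | nil => exact ColLE.nil _
  | cons y c ih =>
    rw [List.pairwise_cons] at h
    exact colLE_cons.2 ⟨(h.1 y (by simp)).le, ih h.2⟩

theorem merge_eq_of_colLE {c t : List ℕ} (h : ColLE c t) : merge c t = (c, t) := by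
  induction t generalizing c with
  | nil => exact merge_nil_right c
  | cons y t ih =>
    cases c with
    | nil => exact absurd h not_colLE_nil_cons
    | cons x c =>
      rw [colLE_cons] at h
      rw [merge_cons_of_le h.1, ih h.2]

theorem merge_snd_sublist (d t : List ℕ) : (merge d t).2.Sublist t := by
  induction t generalizing d with
  | nil => simp [merge_nil_right]
  | cons y t ih =>
    cases d with
    | nil => simp [merge_nil_left]
    | cons x d =>
      by_cases h : x ≤ y
      · rw [merge_cons_of_le h]
        exact (ih d).cons_cons y
      · simp only [merge, h, if_false]
        exact (ih _).cons y

theorem mem_merge_fst {d t : List ℕ} {x : ℕ} (h : x ∈ (merge d t).1) : x ∈ d ∨ x ∈ t := by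
  induction t generalizing d with
  | nil => simpa [merge_nil_right] using h
  | cons y t ih =>
    cases d with
    | nil => simpa [merge_nil_left] using h
    | cons z d =>
      by_cases hz : z ≤ y
      · rw [merge_cons_of_le hz] at h
        rcases List.mem_cons.1 h with h | h
        · simp [h]
        · rcases ih h with h | h <;> simp [h]
      · simp only [merge, hz, if_false] at h
        rcases List.mem_cons.1 h with h | h
        · simp [h]
        · rcases ih h with h | h
          · exact Or.inl h
          · simp [h]

theorem merge_fst_pairwise {d t : List ℕ} (hd : d.Pairwise (· < ·)) (ht : t.Pairwise (· < ·)) :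
    (merge d t).1.Pairwise (· < ·) := by
  induction t generalizing d with
  | nil => simpa [merge_nil_right] using hd
  | cons y t ih =>
    cases d with
    | nil => simpa [merge_nil_left] using ht
    | cons x d =>
      have hd' := List.pairwise_cons.1 hd
      have ht' := List.pairwise_cons.1 ht
      by_cases h : x ≤ y
      · rw [merge_cons_of_le h, List.pairwise_cons]
        refine ⟨fun z hz => ?_, ih hd'.2 ht'.2⟩
        rcases mem_merge_fst hz with hz | hz
        · exact hd'.1 z hz
        · exact h.trans_lt (ht'.1 z hz)
      · simp only [merge, h, if_false]
        rw [List.pairwise_cons]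
        refine ⟨fun z hz => ?_, ih hd ht'.2⟩
        rcases mem_merge_fst hz with hz | hz
        · rcases List.mem_cons.1 hz with rfl | hz
          · omega
          · have := hd'.1 z hz
            omega
        · exact ht'.1 z hz

/-- If `c` fits to the left of `t`, then an entry of `c` is inserted no lower than its row in `c`;
so inserting a part of `c` into `t` gives a column no longer than `c`. -/
theorem merge_fst_length_le {c d t : List ℕ} (hc : c.Pairwise (· < ·)) (h : ColLE c t)
    (hd : d.Sublist c) : (merge d t).1.length ≤ c.length := by
  induction t generalizing c d with
  | nil => simpa [merge_nil_right] using hd.length_le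
  | cons y t ih =>
    cases c with
    | nil => exact absurd h not_colLE_nil_cons
    | cons z c =>
      have h1 := h
      rw [colLE_cons] at h
      rw [List.pairwise_cons] at hc
      cases hd with
      | cons_cons _ hd =>
        rw [merge_cons_of_le h.1]
        simpa using ih hc.2 h.2 hd
      | cons _ hd =>
        cases d with
        | nil => simpa [merge_nil_left] using h1.1
        | cons x d =>
          by_cases hx : x ≤ y
          · rw [merge_cons_of_le hx]
            simpa using ih hc.2 h.2 ((List.sublist_cons_self x d).trans hd)
          · simp only [merge, hx, if_false]
            simpa using ih hc.2 h.2 hd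

/-- Inserting an additional smallest entry only lowers the entries of the resulting column. -/
theorem colLE_merge_cons {w : ℕ} {b t : List ℕ} (hb : (w :: b).Pairwise (· < ·)) :
    ColLE (merge (w :: b) t).1 (merge b t).1 := by
  induction t generalizing w b with
  | nil => simpa [merge_nil_right] using colLE_cons_self hb
  | cons y t ih =>
    have hb' := List.pairwise_cons.1 hb
    by_cases hw : w ≤ y
    · rw [merge_cons_of_le hw]
      cases b with
      | nil => simpa [merge_nil_left] using colLE_cons.2 ⟨hw, ColLE.refl t⟩
      | cons x b =>
        by_cases hx : x ≤ y
        · rw [merge_cons_of_le hx]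
          exact colLE_cons.2 ⟨(hb'.1 x (by simp)).le, ih hb'.2⟩
        · simp only [merge, hx, if_false]
          exact colLE_cons.2 ⟨hw, ColLE.refl _⟩
    · rw [merge_cons_of_forall_lt (d := b) (fun z hz => (not_le.1 hw).trans (hb'.1 z hz))]
      simp only [merge, hw, if_false]
      exact colLE_cons.2 ⟨le_rfl, ih hb⟩

/-- Inserting `d` into `t`, and the bumped entries into the next column `s`, leaves the two columns
semistandard. -/
theorem colLE_merge_merge {d t s : List ℕ} (hd : d.Pairwise (· < ·)) (ht : t.Pairwise (· < ·))
    (h : ColLE t s) : ColLE (merge d t).1 (merge (merge d t).2 s).1 := by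
  induction t generalizing d s with
  | nil =>
    cases s with
    | nil => simpa [merge_nil_right] using ColLE.nil d
    | cons z s => exact absurd h not_colLE_nil_cons
  | cons y t ih =>
    have ht' := List.pairwise_cons.1 ht
    cases d with
    | nil => simpa [merge_nil_left] using h
    | cons x d =>
      have hd' := List.pairwise_cons.1 hd
      have hbs : ∀ e, (merge e t).2.Pairwise (· < ·) := fun e =>
        ht'.2.sublist (merge_snd_sublist e t)
      have hs' : s = [] ∨ ∃ z s', s = z :: s' ∧ y ≤ z ∧ ColLE t s' := by
        cases s with
        | nil => simp
        | cons z s =>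
          rw [colLE_cons] at h
          exact Or.inr ⟨z, s, rfl, h⟩
      by_cases hx : x ≤ y
      · rw [merge_cons_of_le hx]
        rcases hs' with rfl | ⟨z, s', rfl, hyz, hts⟩
        · simpa [merge_nil_right] using
            colLE_cons.2 ⟨hx, by simpa [merge_nil_right] using ih hd'.2 ht'.2 (ColLE.nil t)⟩
        · dsimp only
          rw [merge_cons_of_le hyz]
          exact colLE_cons.2 ⟨hx, ih hd'.2 ht'.2 hts⟩
      · have hm : merge (x :: d) (y :: t) =
            (y :: (merge (x :: d) t).1, (merge (x :: d) t).2) := by simp [merge, hx]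
        have hfst := merge_fst_pairwise hd ht
        have hsub := merge_snd_sublist (x :: d) t
        have hsrt := hbs (x :: d)
        have IH := fun s' (hts : ColLE t s') => ih (d := x :: d) (s := s') hd ht'.2 hts
        rw [hm] at hfst ⊢
        dsimp only at hfst ⊢
        generalize (merge (x :: d) t).1 = p at *
        generalize (merge (x :: d) t).2 = b at *
        rcases hs' with rfl | ⟨z, s', rfl, hyz, hts⟩
        · exact (colLE_cons_self hfst).trans (IH [] (ColLE.nil t))
        · have IH' := IH s' hts
          cases b with
          | nil =>
            rw [merge_nil_left] at IH' ⊢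
            exact colLE_cons.2 ⟨hyz, IH'⟩
          | cons w b =>
            by_cases hw : w ≤ z
            · rw [merge_cons_of_le hw]
              exact colLE_cons.2 ⟨(ht'.1 w (hsub.subset (by simp))).le,
                IH'.trans (colLE_merge_cons hsrt)⟩
            · simp only [merge, hw, if_false]
              exact colLE_cons.2 ⟨hyz, IH'⟩

/-- The columns `T` form a semistandard tableau without empty columns. -/
def IsSemistd : List (List ℕ) → Prop
  | [] => True
  | c :: T => c ≠ [] ∧ c.Pairwise (· < ·) ∧ ColLE c (T.headD []) ∧ IsSemistd T

theorem colMul_eq_cons {c : List ℕ} {T : List (List ℕ)} (h : IsSemistd (c :: T)) :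
    colMul c T = c :: T := by
  induction T generalizing c with
  | nil => exact colMul_nil_right h.2.1 h.1
  | cons t T ih =>
    have hm : merge c t = (c, t) := merge_eq_of_colLE h.2.2.1
    rw [colMul_cons h.2.1, hm, ih h.2.2.2]

theorem size_nil : size [] = 0 := rfl

theorem size_cons (c : List ℕ) (T : List (List ℕ)) : size (c :: T) = c.length + size T := by
  simp [size]

theorem size_colInsert (x : ℕ) (T : List (List ℕ)) : size (colInsert x T) = size T + 1 := by
  have hb : ∀ x c, (colBump x c).1.length + (colBump x c).2.toList.length = c.length + 1 := by
    intro x c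
    induction c with
    | nil => simp [colBump]
    | cons y c ih =>
      by_cases h : x ≤ y
      · simp [colBump, h]
      · simp [colBump, h]
        omega
  induction T generalizing x with
  | nil => simp [colInsert, size]
  | cons c T ih =>
    have := hb x c
    rw [colInsert]
    rcases hb' : colBump x c with ⟨c', _ | y⟩ <;> rw [hb'] at this
    · simp [size] at this ⊢
      omega
    · have h2 := ih y
      simp [size] at this h2 ⊢
      omega

theorem size_colMul (d : List ℕ) (T : List (List ℕ)) :
    size (colMul d T) = size T + d.length := by
  induction d generalizing T with
  | nil => simp [colMul]
  | cons x d ih =>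
    have h1 : colMul (x :: d) T = colMul d (colInsert x T) := rfl
    rw [h1, ih, size_colInsert, List.length_cons]
    omega

/-- The last clause gives the first column of the product; it makes the induction go through. -/
theorem colMul_semistd {c d : List ℕ} {T : List (List ℕ)} (hc : c.Pairwise (· < ·))
    (h : ColLE c (T.headD [])) (hT : IsSemistd T) (hd : d.Sublist c) :
    IsSemistd (colMul d T) ∧ (∀ i j, InShape (colMul d T) i j → InShape (c :: T) i j) ∧
      (colMul d T).headD [] = (merge d (T.headD [])).1 := by
  induction T generalizing c d with
  | nil =>
    cases d with
    | nil =>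
      refine ⟨trivial, fun i j hij => ?_, by simp [colMul, merge_nil_right]⟩
      simp [InShape, colMul] at hij
    | cons x d =>
      rw [colMul_nil_right (hc.sublist hd) (by simp)]
      refine ⟨⟨by simp, hc.sublist hd, ColLE.nil _, trivial⟩, fun i j hij => ?_, ?_⟩
      · cases j with
        | zero => exact lt_of_lt_of_le hij hd.length_le
        | succ j => simp [InShape] at hij
      · simp [merge_nil_right]
  | cons t T ih =>
    rw [colMul_cons (hc.sublist hd)]
    obtain ⟨i1, i2, i3⟩ := ih hT.2.1 hT.2.2.1 hT.2.2.2 (merge_snd_sublist d t)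
    refine ⟨⟨?_, merge_fst_pairwise (hc.sublist hd) hT.2.1, ?_, i1⟩, fun i j hij => ?_, rfl⟩
    · intro h0
      have hle : t.length ≤ (merge d t).1.length := by
        have := (colLE_merge_merge (s := t) (hc.sublist hd) hT.2.1 (ColLE.refl t)).1
        have h2 : ∀ b s : List ℕ, s.length ≤ (merge b s).1.length := by
          intro b s
          induction s generalizing b with
          | nil => simp
          | cons y s ih =>
            cases b with
            | nil => simp [merge_nil_left]
            | cons x b =>
              by_cases hx : x ≤ y
              · simpa [merge, hx] using ih b
              · simpa [merge, hx] using ih (x :: b)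
        exact h2 d t
      rw [h0] at hle
      exact hT.1 (List.length_eq_zero_iff.1 (by simpa using hle))
    · rw [i3]
      exact colLE_merge_merge (hc.sublist hd) hT.2.1 hT.2.2.1
    · cases j with
      | zero => exact lt_of_lt_of_le hij (merge_fst_length_le hc h hd)
      | succ j => exact i2 i j hij

/-- The case of `merge_injective` in which the two insertions first behave differently cannot
occur: from there on the second insertion has bumped strictly more entries. -/
theorem merge_ne {d₁ t₁ d₂ t₂ q : List ℕ} (ht : t₁.Pairwise (· < ·))
    (h1 : (merge d₁ t₁).1 = (merge d₂ t₂).1) (h2 : (merge d₂ t₂).2 = q ++ (merge d₁ t₁).2)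
    (hl : t₁.length = t₂.length) (hq : q ≠ []) (hqt : ∀ y ∈ q, ∀ z ∈ t₁, y < z) : False := by
  induction t₁ generalizing d₁ d₂ t₂ q with
  | nil =>
    have ht2 : t₂ = [] := List.length_eq_zero_iff.1 hl.symm
    subst ht2
    simp [merge_nil_right] at h2
    exact hq h2
  | cons y₁ t₁ ih =>
    cases t₂ with
    | nil => simp at hl
    | cons y₂ t₂ =>
      have hl' : t₁.length = t₂.length := by simpa using hl
      have ht' := List.pairwise_cons.1 ht
      cases d₂ with
      | nil =>
        rw [merge_nil_left] at h2
        simp at h2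
        exact hq h2.1
      | cons x₂ d₂ =>
        obtain ⟨a, q, rfl⟩ := List.exists_cons_of_ne_nil hq
        by_cases hx₁ : ∃ x d, d₁ = x :: d ∧ x ≤ y₁
        · obtain ⟨x₁, d, rfl, hx₁⟩ := hx₁
          rw [merge_cons_of_le hx₁] at h1 h2
          by_cases hx₂ : x₂ ≤ y₂
          · rw [merge_cons_of_le hx₂] at h1 h2
            simp at h1 h2
            refine ih (q := q ++ [y₁]) ht'.2 h1.2 (by simpa using h2.2) hl' (by simp) ?_
            intro y hy z hz
            simp at hy
            rcases hy with hy | rfl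
            · exact hqt y (by simp [hy]) z (by simp [hz])
            · exact ht'.1 z hz
          · simp only [merge, hx₂, if_false] at h1 h2
            simp at h1
            refine ih (q := (a :: q) ++ [y₁]) ht'.2 h1.2 (by simpa using h2) hl' (by simp) ?_
            intro y hy z hz
            rcases List.mem_append.1 hy with hy | hy
            · exact hqt y hy z (by simp [hz])
            · simp at hy
              exact hy ▸ ht'.1 z hz
        · have hm : merge d₁ (y₁ :: t₁) = (y₁ :: (merge d₁ t₁).1, (merge d₁ t₁).2) := by
            cases d₁ with
            | nil => simp [merge_nil_left]
            | cons x d =>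
              have : ¬ x ≤ y₁ := fun h => hx₁ ⟨x, d, rfl, h⟩
              simp [merge, this]
          rw [hm] at h1 h2
          by_cases hx₂ : x₂ ≤ y₂
          · rw [merge_cons_of_le hx₂] at h1 h2
            simp at h1 h2
            have := hqt a (by simp) y₁ (by simp)
            omega
          · simp only [merge, hx₂, if_false] at h1 h2
            simp at h1
            exact ih ht'.2 h1.2 h2 hl' (by simp) fun y hy z hz => hqt y hy z (by simp [hz])

theorem merge_cons_cases (d t : List ℕ) (y : ℕ) :
    (∃ x e, d = x :: e ∧ x ≤ y ∧
        merge d (y :: t) = (x :: (merge e t).1, y :: (merge e t).2)) ∨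
      ((∀ x e, d = x :: e → y < x) ∧
        merge d (y :: t) = (y :: (merge d t).1, (merge d t).2)) := by
  cases d with
  | nil => simp [merge_nil_left]
  | cons x d =>
    by_cases hx : x ≤ y
    · exact Or.inl ⟨x, d, rfl, hx, merge_cons_of_le hx d t⟩
    · refine Or.inr ⟨?_, by simp [merge, hx]⟩
      rintro _ _ ⟨rfl, rfl⟩
      omega

theorem merge_injective {d₁ t₁ d₂ t₂ : List ℕ} (ht₁ : t₁.Pairwise (· < ·))
    (ht₂ : t₂.Pairwise (· < ·)) (h : merge d₁ t₁ = merge d₂ t₂)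
    (hl : t₁.length = t₂.length) : d₁ = d₂ ∧ t₁ = t₂ := by
  induction t₁ generalizing d₁ d₂ t₂ with
  | nil =>
    have ht2 : t₂ = [] := List.length_eq_zero_iff.1 hl.symm
    subst ht2
    simpa [merge_nil_right] using h
  | cons y₁ t₁ ih =>
    cases t₂ with
    | nil => simp at hl
    | cons y₂ t₂ =>
      have hl' : t₁.length = t₂.length := by simpa using hl
      have h₁ := List.pairwise_cons.1 ht₁
      have h₂ := List.pairwise_cons.1 ht₂
      rcases merge_cons_cases d₁ t₁ y₁ with ⟨x₁, e₁, rfl, hx₁, hm₁⟩ | ⟨hx₁, hm₁⟩ <;>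
      rcases merge_cons_cases d₂ t₂ y₂ with ⟨x₂, e₂, rfl, hx₂, hm₂⟩ | ⟨hx₂, hm₂⟩ <;>
      rw [hm₁, hm₂] at h <;> simp only [Prod.mk.injEq, List.cons.injEq] at h
      · obtain ⟨⟨rfl, h3⟩, rfl, h4⟩ := h
        obtain ⟨rfl, rfl⟩ := ih h₁.2 h₂.2 (Prod.ext h3 h4) hl'
        exact ⟨rfl, rfl⟩
      · refine (merge_ne (q := [y₁]) h₁.2 h.1.2 h.2.symm hl' (by simp) ?_).elim
        simpa using h₁.1
      · refine (merge_ne (q := [y₂]) h₂.2 h.1.2.symm h.2 hl'.symm (by simp) ?_).elim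
        simpa using h₂.1
      · obtain ⟨⟨rfl, h3⟩, h4⟩ := h
        obtain ⟨rfl, rfl⟩ := ih h₁.2 h₂.2 (Prod.ext h3 h4) hl'
        exact ⟨rfl, rfl⟩

theorem colMul_injective {d₁ d₂ : List ℕ} {T₁ T₂ : List (List ℕ)} (hd₁ : d₁.Pairwise (· < ·))
    (hd₂ : d₂.Pairwise (· < ·)) (h₁ : ∀ t ∈ T₁, t.Pairwise (· < ·))
    (h₂ : ∀ t ∈ T₂, t.Pairwise (· < ·)) (hl : T₁.map List.length = T₂.map List.length)
    (h : colMul d₁ T₁ = colMul d₂ T₂) : d₁ = d₂ ∧ T₁ = T₂ := by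
  induction T₁ generalizing d₁ d₂ T₂ with
  | nil =>
    have : T₂ = [] := by simpa using hl.symm
    subst this
    refine ⟨?_, rfl⟩
    by_cases e₁ : d₁ = []
    · by_cases e₂ : d₂ = []
      · rw [e₁, e₂]
      · rw [colMul_nil_right hd₂ e₂, e₁] at h
        simp [colMul] at h
    · by_cases e₂ : d₂ = []
      · rw [colMul_nil_right hd₁ e₁, e₂] at h
        simp [colMul] at h
      · rw [colMul_nil_right hd₁ e₁, colMul_nil_right hd₂ e₂] at h
        simpa using h
  | cons t₁ T₁ ih =>
    cases T₂ with
    | nil => simp at hl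
    | cons t₂ T₂ =>
      rw [colMul_cons hd₁, colMul_cons hd₂] at h
      simp only [List.cons.injEq, List.map_cons, List.mem_cons, forall_eq_or_imp] at h hl h₁ h₂
      obtain ⟨h3, rfl⟩ := ih (h₁.1.sublist (merge_snd_sublist _ _))
        (h₂.1.sublist (merge_snd_sublist _ _)) h₁.2 h₂.2 hl.2 h.2
      obtain ⟨rfl, rfl⟩ := merge_injective h₁.1 h₂.1 (Prod.ext h.1 h3) hl.1
      exact ⟨rfl, rfl⟩

theorem size_le_of_inShape {A B : List (List ℕ)} (h : ∀ i j, InShape A i j → InShape B i j) :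
    size A ≤ size B := by
  induction A generalizing B with
  | nil => simp [size]
  | cons a A ih =>
    have h0 : a.length ≤ (B.headD []).length := by
      by_contra hlt
      have := h (B.headD []).length 0 (by simpa [InShape] using hlt)
      cases B <;> simp [InShape] at this
    have h1 : size A ≤ size B.tail := ih fun i j hij => by
      have := h i (j + 1) hij
      cases B with
      | nil => simp [InShape] at this
      | cons b B => exact this
    cases B with
    | nil =>
      simp only [List.headD_nil, List.tail_nil, List.length_nil, size_nil, size_cons] at *
      omega
    | cons b B =>
      simp only [List.headD_cons, List.tail_cons, size_cons] at *
      omega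

theorem red_sublist (c : List ℕ) : (red c).Sublist c := List.filter_sublist

theorem suc_semistd {T : List (List ℕ)} (hT : IsSemistd T) :
    IsSemistd (suc T) ∧ ∀ i j, InShape (suc T) i j → InShape T i j := by
  cases T with
  | nil => exact ⟨trivial, fun _ _ h => h⟩
  | cons c T =>
    have := colMul_semistd hT.2.1 hT.2.2.1 hT.2.2.2 (red_sublist c)
    exact ⟨this.1, this.2.1⟩

theorem suc_eq_self_of_red {c : List ℕ} {T : List (List ℕ)} (h : IsSemistd (c :: T))
    (hc : red c = c) : suc (c :: T) = c :: T := by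
  rw [suc, hc, colMul_eq_cons h]

/-- A step that does not lower the number of cells removes nothing, and then puts the first column
back in its place. -/
theorem suc_eq_self_of_size {T : List (List ℕ)} (hT : IsSemistd T) (h : size T ≤ size (suc T)) :
    suc T = T := by
  cases T with
  | nil => rfl
  | cons c T =>
    refine suc_eq_self_of_red hT ((red_sublist c).eq_of_length_le ?_)
    rw [suc, size_colMul, size_cons] at h
    omega

theorem iterate_suc {T : List (List ℕ)} (h : suc (suc T) = suc T) {k : ℕ} (hk : k ≠ 0) :
    suc^[k] T = suc T := by
  obtain ⟨k, rfl⟩ := Nat.exists_eq_succ_of_ne_zero hk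
  rw [Function.iterate_succ_apply]
  exact Function.iterate_fixed h k

theorem PAII_eq_suc {T : List (List ℕ)} (hT : IsSemistd T) (h : suc (suc T) = suc T) :
    PAII T = suc T := by
  cases T with
  | nil => rfl
  | cons c T =>
    refine iterate_suc h ?_
    have := List.length_pos_iff.2 hT.1
    rw [size_cons]
    omega

/-! ### The reduction of a column, pair by pair -/

/-- A largest entry that does not complete a pair is irrelevant for the removable entries. -/
theorem remRev_cons_of_not {y : ℕ} {t : List ℕ} (h : ∀ x ∈ t, ¬ (Even y ∧ y = x + 1)) :
    remRev (y :: t) = remRev t := by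
  cases t with
  | nil => rfl
  | cons x t =>
    have := h x (by simp)
    rw [remRev, if_neg fun h' => this ⟨h'.1, h'.2.1⟩]

/-- The entries of `c` in the first `j` pairs `{1, 2}, {3, 4}, ...` -/
def lowPart (c : List ℕ) (j : ℕ) : List ℕ := c.filter (· ≤ 2 * j)

/-- The removable entries of `lowPart c j`. -/
def remLow (c : List ℕ) (j : ℕ) : List ℕ := remRev (lowPart c j).reverse

/-- The number of those among the first `j` pairs that do not meet `c`. -/
def emptyPairs (c : List ℕ) (j : ℕ) : ℕ :=
  ((Finset.range j).filter fun i => 2 * i + 1 ∉ c ∧ 2 * i + 2 ∉ c).card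

theorem lowPart_zero {c : List ℕ} (hpos : ∀ x ∈ c, 1 ≤ x) : lowPart c 0 = [] := by
  simp only [lowPart, List.filter_eq_nil_iff]
  intro x hx
  have := hpos x hx
  simp
  omega

theorem lowPart_succ {c : List ℕ} (hc : c.Pairwise (· < ·)) (j : ℕ) :
    lowPart c (j + 1) = lowPart c j ++ ((if 2 * j + 1 ∈ c then [2 * j + 1] else []) ++
      if 2 * j + 2 ∈ c then [2 * j + 2] else []) := by
  refine List.Pairwise.eq_of_mem_iff (hc.sublist List.filter_sublist) ?_ fun x => ?_
  · rw [List.pairwise_append]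
    refine ⟨hc.sublist List.filter_sublist, ?_, ?_⟩
    · split_ifs <;> simp
    · intro a ha b hb
      simp only [lowPart, List.mem_filter, decide_eq_true_eq] at ha
      split_ifs at hb <;> simp at hb <;> omega
  · have h1 : ∀ a, x ∈ (if a ∈ c then [a] else []) ↔ x ∈ c ∧ x = a := by
      intro a
      split_ifs with h
      · simp only [List.mem_singleton]
        exact ⟨fun e => ⟨e ▸ h, e⟩, fun e => e.2⟩
      · simp only [List.not_mem_nil, false_iff]
        rintro ⟨h', rfl⟩
        exact h h'
    simp only [lowPart, List.mem_append, h1, List.mem_filter, decide_eq_true_eq, ← and_or_left]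
    refine and_congr_right fun _ => ?_
    omega

theorem mem_lowPart {c : List ℕ} {j x : ℕ} : x ∈ lowPart c j ↔ x ∈ c ∧ x ≤ 2 * j := by
  simp [lowPart]

/-- The removable entries, pair by pair: only a pair contained in `c` can become removable. -/
theorem remLow_succ {c : List ℕ} (hc : c.Pairwise (· < ·)) (j : ℕ) :
    remLow c (j + 1) =
      if 2 * j + 1 ∈ c ∧ 2 * j + 2 ∈ c ∧
          2 * j + 2 + (remLow c j).length + 1 < 2 * ((lowPart c j).length + 2) then
        (2 * j + 2) :: (2 * j + 1) :: remLow c j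
      else remLow c j := by
  have hodd : remRev ((2 * j + 1) :: (lowPart c j).reverse) = remRev (lowPart c j).reverse := by
    refine remRev_cons_of_not fun x _ h => ?_
    have := Nat.even_iff.1 h.1
    omega
  have heven : 2 * j + 1 ∉ c →
      remRev ((2 * j + 2) :: (lowPart c j).reverse) = remRev (lowPart c j).reverse := by
    intro h1
    refine remRev_cons_of_not fun x hx h => ?_
    rw [List.mem_reverse, mem_lowPart] at hx
    omega
  unfold remLow
  rw [lowPart_succ hc]
  by_cases h1 : 2 * j + 1 ∈ c <;> by_cases h2 : 2 * j + 2 ∈ c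
  · simp only [h1, h2, if_true, true_and, List.reverse_append, List.reverse_cons,
      List.reverse_nil, List.nil_append, List.cons_append]
    rw [remRev, hodd]
    have he : Even (2 * j + 2) := ⟨j + 1, by omega⟩
    simp only [he, true_and, List.length_reverse]
  · simp [h1, h2, hodd]
  · simp [h1, h2, heven h1]
  · simp [h1, h2]

theorem mem_remLow_le {c : List ℕ} (hc : c.Pairwise (· < ·)) (hpos : ∀ x ∈ c, 1 ≤ x) {j x : ℕ}
    (h : x ∈ remLow c j) : x ∈ c ∧ 1 ≤ x ∧ x ≤ 2 * j := by
  induction j with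
  | zero => simp [remLow, lowPart_zero hpos, remRev] at h
  | succ j ih =>
    rw [remLow_succ hc] at h
    split_ifs at h with h'
    · simp only [List.mem_cons] at h
      rcases h with rfl | rfl | h
      · exact ⟨h'.2.1, by omega, by omega⟩
      · exact ⟨h'.1, by omega, by omega⟩
      · obtain ⟨h1, h2, h3⟩ := ih h
        exact ⟨h1, h2, by omega⟩
    · obtain ⟨h1, h2, h3⟩ := ih h
      exact ⟨h1, h2, by omega⟩

theorem mem_remLow_iff_of_le {c : List ℕ} (hc : c.Pairwise (· < ·)) {i j x : ℕ} (hij : i ≤ j)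
    (hx : x ≤ 2 * i) : x ∈ remLow c j ↔ x ∈ remLow c i := by
  induction j, hij using Nat.le_induction with
  | base => rfl
  | succ j hj ih =>
    rw [← ih, remLow_succ hc]
    split_ifs
    · simp only [List.mem_cons]
      exact ⟨fun h => by rcases h with h | h | h <;> [omega; omega; exact h],
        fun h => Or.inr (Or.inr h)⟩
    · rfl

theorem mem_remLow_full_iff {c : List ℕ} (hc : c.Pairwise (· < ·)) (hpos : ∀ x ∈ c, 1 ≤ x)
    {i x : ℕ} (h1 : 2 * i + 1 ≤ x) :
    x ∈ remLow c (i + 1) ↔ x ≤ 2 * i + 2 ∧ 2 * i + 1 ∈ c ∧ 2 * i + 2 ∈ c ∧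
      2 * i + 2 + (remLow c i).length + 1 < 2 * ((lowPart c i).length + 2) := by
  have hn : x ∉ remLow c i := fun h => by
    have := mem_remLow_le hc hpos h
    omega
  rw [remLow_succ hc]
  split_ifs with h
  · simp only [List.mem_cons, hn, or_false, h, and_true]
    omega
  · simp [hn, h]

theorem emptyPairs_succ (c : List ℕ) (j : ℕ) : emptyPairs c (j + 1) =
    emptyPairs c j + if 2 * j + 1 ∉ c ∧ 2 * j + 2 ∉ c then 1 else 0 := by
  rw [emptyPairs, Finset.range_add_one, Finset.filter_insert]
  split_ifs
  · rw [Finset.card_insert_of_notMem (by simp)]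
    rfl
  · rfl

theorem emptyPairs_eq_zero_iff {c : List ℕ} {j : ℕ} :
    emptyPairs c j = 0 ↔ ∀ i < j, 2 * i + 1 ∈ c ∨ 2 * i + 2 ∈ c := by
  simp only [emptyPairs, Finset.card_eq_zero, Finset.filter_eq_empty_iff, Finset.mem_range]
  refine forall₂_congr fun i _ => ?_
  tauto

/-- As long as every pair contained in `c` is removable, each pair adds one to the number of kept
entries plus the number of removable pairs plus the number of empty pairs. -/
theorem two_mul_length_lowPart {c : List ℕ} (hc : c.Pairwise (· < ·)) (hpos : ∀ x ∈ c, 1 ≤ x)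
    {j : ℕ} (h : ∀ i < j, 2 * i + 1 ∈ c → 2 * i + 2 ∈ c → 2 * i + 2 ∈ remLow c (i + 1)) :
    2 * (lowPart c j).length + 2 * emptyPairs c j = (remLow c j).length + 2 * j := by
  induction j with
  | zero => simp [remLow, lowPart_zero hpos, remRev, emptyPairs]
  | succ j ih =>
    have ih := ih fun i hi => h i (hi.trans j.lt_succ_self)
    have hj := h j j.lt_succ_self
    rw [mem_remLow_full_iff hc hpos (by omega)] at hj
    rw [remLow_succ hc, lowPart_succ hc, emptyPairs_succ]
    by_cases h1 : 2 * j + 1 ∈ c <;> by_cases h2 : 2 * j + 2 ∈ c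
    · have h3 := (hj h1 h2).2.2.2
      simp [h1, h2, h3]
      omega
    all_goals
      simp [h1, h2]
      omega

/-- A pair contained in `c` is removable exactly if no pair before it is empty. -/
theorem mem_remLow_iff_emptyPairs {c : List ℕ} (hc : c.Pairwise (· < ·))
    (hpos : ∀ x ∈ c, 1 ≤ x) {j : ℕ}
    (h : ∀ i < j, 2 * i + 1 ∈ c → 2 * i + 2 ∈ c → 2 * i + 2 ∈ remLow c (i + 1))
    (h1 : 2 * j + 1 ∈ c) (h2 : 2 * j + 2 ∈ c) :
    2 * j + 2 ∈ remLow c (j + 1) ↔ emptyPairs c j = 0 := by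
  have := two_mul_length_lowPart hc hpos h
  rw [mem_remLow_full_iff hc hpos (by omega)]
  simp only [h1, h2, true_and]
  omega

theorem mem_remRev_iff {c : List ℕ} (hc : c.Pairwise (· < ·)) {i x : ℕ} (hi : x ≤ 2 * i) :
    x ∈ remRev c.reverse ↔ x ∈ remLow c i := by
  obtain ⟨m, him, hm⟩ : ∃ m, i ≤ m ∧ ∀ x ∈ c, x ≤ 2 * m := by
    refine ⟨i + c.sum, by omega, fun x hx => ?_⟩
    have := List.single_le_sum (by simp) x hx
    omega
  rw [← mem_remLow_iff_of_le hc him hi, remLow, lowPart, List.filter_eq_self.2 (by simpa using hm)]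

theorem mem_red {c : List ℕ} {x : ℕ} : x ∈ red c ↔ x ∈ c ∧ x ∉ remRev c.reverse := by
  simp [red]

/-- The entries of `c` that belong to the pairs numbered by `r` are the `f k`, `k ∈ r`; each other
pair is contained in `c` or disjoint from it, and the pairs contained in `c` precede the
disjoint ones. Pair number `i + 1` is `{2 * i + 1, 2 * i + 2}`. -/
structure PairPattern (f : ℕ → ℕ) (r c : List ℕ) : Prop where
  mem : ∀ i, i + 1 ∈ r → f (i + 1) ∈ c ∧ ¬ (2 * i + 1 ∈ c ∧ 2 * i + 2 ∈ c)
  iff : ∀ i, i + 1 ∉ r → (2 * i + 1 ∈ c ↔ 2 * i + 2 ∈ c)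
  lower : ∀ i j, i < j → i + 1 ∉ r → j + 1 ∉ r → 2 * j + 2 ∈ c → 2 * i + 2 ∈ c

/-- `f` selects an element of each pair `{2 * i + 1, 2 * i + 2}`; this holds for `u` and `v`. -/
def IsSelector (f : ℕ → ℕ) : Prop := ∀ i, f (i + 1) = 2 * i + 1 ∨ f (i + 1) = 2 * i + 2

theorem exists_pair {x : ℕ} (hx : 1 ≤ x) : ∃ i, x = 2 * i + 1 ∨ x = 2 * i + 2 :=
  ⟨(x - 1) / 2, by omega⟩

theorem IsSelector.mem_map_iff {f : ℕ → ℕ} (hf : IsSelector f) {r : List ℕ}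
    (hr : ∀ k ∈ r, 1 ≤ k) {i x : ℕ} (hx : x = 2 * i + 1 ∨ x = 2 * i + 2) :
    x ∈ r.map f ↔ i + 1 ∈ r ∧ x = f (i + 1) := by
  rw [List.mem_map]
  constructor
  · rintro ⟨k, hk, rfl⟩
    obtain ⟨k, rfl⟩ := Nat.exists_eq_add_of_le' (hr k hk)
    have : k = i := by
      have := hf k
      omega
    subst this
    exact ⟨hk, rfl⟩
  · rintro ⟨h, rfl⟩
    exact ⟨_, h, rfl⟩

theorem IsSelector.strictMono {f : ℕ → ℕ} (hf : IsSelector f) :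
    StrictMono fun i => f (i + 1) := by
  refine strictMono_nat_of_lt_succ fun i => ?_
  have h1 := hf i
  have h2 := hf (i + 1)
  omega

theorem IsSelector.pairwise_map {f : ℕ → ℕ} (hf : IsSelector f) {r : List ℕ}
    (hr : ∀ k ∈ r, 1 ≤ k) (hs : r.Pairwise (· < ·)) : (r.map f).Pairwise (· < ·) := by
  rw [List.pairwise_map]
  refine hs.imp_of_mem fun {a b} ha hb hab => ?_
  obtain ⟨a, rfl⟩ := Nat.exists_eq_add_of_le' (hr a ha)
  obtain ⟨b, rfl⟩ := Nat.exists_eq_add_of_le' (hr b hb)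
  exact hf.strictMono (by omega)

theorem PairPattern.red_eq {f : ℕ → ℕ} (hf : IsSelector f) {r c : List ℕ}
    (hr : ∀ k ∈ r, 1 ≤ k) (hs : r.Pairwise (· < ·)) (hc : c.Pairwise (· < ·))
    (hpos : ∀ x ∈ c, 1 ≤ x) (h : PairPattern f r c) : red c = r.map f := by
  have hrem : ∀ j, 2 * j + 1 ∈ c → 2 * j + 2 ∈ c → 2 * j + 2 ∈ remLow c (j + 1) := by
    intro j
    induction j using Nat.strong_induction_on with
    | _ j ih =>
      intro h1 h2
      rw [mem_remLow_iff_emptyPairs hc hpos ih h1 h2, emptyPairs_eq_zero_iff]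
      intro i hi
      by_cases hir : i + 1 ∈ r
      · rcases hf i with hfi | hfi <;> have := (h.mem i hir).1 <;> rw [hfi] at this
        · exact Or.inl this
        · exact Or.inr this
      · exact Or.inr (h.lower i j hi hir (fun hj => (h.mem j hj).2 ⟨h1, h2⟩) h2)
  refine List.Pairwise.eq_of_mem_iff (hc.sublist (red_sublist c)) (hf.pairwise_map hr hs)
    fun x => ?_
  rw [mem_red]
  by_cases hx : x ∈ c
  · obtain ⟨i, hi⟩ := exists_pair (hpos x hx)
    rw [mem_remRev_iff hc (i := i + 1) (by omega), hf.mem_map_iff hr hi,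
      mem_remLow_full_iff hc hpos (by omega)]
    simp only [hx, true_and]
    by_cases hir : i + 1 ∈ r
    · obtain ⟨h1, h2⟩ := h.mem i hir
      simp only [hir, true_and]
      refine ⟨fun _ => ?_, fun _ h' => h2 ⟨h'.2.1, h'.2.2.1⟩⟩
      by_contra hne
      rcases hi with rfl | rfl <;> rcases hf i with e | e <;> rw [e] at h1 hne
      · exact hne rfl
      · exact h2 ⟨hx, h1⟩
      · exact h2 ⟨h1, hx⟩
      · exact hne rfl
    · have h3 := h.iff i hir
      have hboth : 2 * i + 1 ∈ c ∧ 2 * i + 2 ∈ c := by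
        rcases hi with rfl | rfl
        · exact ⟨hx, h3.1 hx⟩
        · exact ⟨h3.2 hx, hx⟩
      have := hrem i hboth.1 hboth.2
      rw [mem_remLow_full_iff hc hpos (by omega)] at this
      simp only [hir, false_and, iff_false, not_not]
      exact ⟨by omega, this.2⟩
  · simp only [hx, false_and, false_iff]
    intro hx'
    obtain ⟨k, hk, rfl⟩ := List.mem_map.1 hx'
    obtain ⟨k, rfl⟩ := Nat.exists_eq_add_of_le' (hr k hk)
    exact hx (h.mem k hk).1

theorem pairPattern_of_red_eq {f : ℕ → ℕ} (hf : IsSelector f) {r c : List ℕ}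
    (hr : ∀ k ∈ r, 1 ≤ k) (hc : c.Pairwise (· < ·))
    (hpos : ∀ x ∈ c, 1 ≤ x) (h : red c = r.map f) : PairPattern f r c := by
  have hmem : ∀ i x, x = 2 * i + 1 ∨ x = 2 * i + 2 → x ∈ c →
      (x ∉ remLow c (i + 1) ↔ i + 1 ∈ r ∧ x = f (i + 1)) := by
    intro i x hi hx
    rw [← hf.mem_map_iff hr hi, ← h, mem_red, mem_remRev_iff hc (i := i + 1) (by omega)]
    simp [hx]
  -- The two entries of a pair are removed together, and `r.map f` does not contain both.
  have hrem : ∀ j, 2 * j + 1 ∈ c → 2 * j + 2 ∈ c → 2 * j + 2 ∈ remLow c (j + 1) := by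
    intro j h1 h2
    by_contra hn
    have hn' : 2 * j + 1 ∉ remLow c (j + 1) := by
      rw [mem_remLow_full_iff hc hpos (by omega)] at hn ⊢
      exact fun h' => hn ⟨le_rfl, h'.2⟩
    have := ((hmem j _ (Or.inl rfl) h1).1 hn').2
    have := ((hmem j _ (Or.inr rfl) h2).1 hn).2
    omega
  have hsingle : ∀ i x, x = 2 * i + 1 ∨ x = 2 * i + 2 → x ∈ c → i + 1 ∉ r →
      2 * i + 1 ∈ c ∧ 2 * i + 2 ∈ c := by
    intro i x hi hx hir
    by_contra hn
    have : x ∉ remLow c (i + 1) := by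
      rw [mem_remLow_full_iff hc hpos (by omega)]
      exact fun h' => hn ⟨h'.2.1, h'.2.2.1⟩
    exact hir ((hmem i x hi hx).1 this).1
  have hiff : ∀ i, i + 1 ∉ r → (2 * i + 1 ∈ c ↔ 2 * i + 2 ∈ c) := fun i hir =>
    ⟨fun h' => (hsingle i _ (Or.inl rfl) h' hir).2, fun h' => (hsingle i _ (Or.inr rfl) h' hir).1⟩
  refine ⟨fun i hir => ?_, hiff, fun i j hij hir hjr hj => ?_⟩
  · have h1 : f (i + 1) ∈ red c := h ▸ List.mem_map.2 ⟨_, hir, rfl⟩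
    have h2 := mem_red.1 h1
    refine ⟨h2.1, fun hb => h2.2 ?_⟩
    have h3 := hf i
    have h4 := hrem i hb.1 hb.2
    rw [mem_remRev_iff hc (i := i + 1) (by omega)]
    rw [mem_remLow_full_iff hc hpos (by omega)] at h4 ⊢
    exact ⟨by omega, h4.2⟩
  · have h1 := (hiff j hjr).2 hj
    have h2 := (mem_remLow_iff_emptyPairs hc hpos (fun i _ => hrem i) h1 hj).1 (hrem j h1 hj)
    rcases emptyPairs_eq_zero_iff.1 h2 i hij with h3 | h3
    · exact (hiff i hir).1 h3
    · exact h3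

theorem PairPattern.subset_or_subset {f : ℕ → ℕ} (hf : IsSelector f) {r c c' : List ℕ}
    (hpos : ∀ x ∈ c, 1 ≤ x) (hpos' : ∀ x ∈ c', 1 ≤ x) (h : PairPattern f r c)
    (h' : PairPattern f r c') : c ⊆ c' ∨ c' ⊆ c := by
  have key : ∀ {c c' : List ℕ}, (∀ x ∈ c, 1 ≤ x) → PairPattern f r c → PairPattern f r c' →
      (∀ i, i + 1 ∉ r → 2 * i + 2 ∈ c → 2 * i + 2 ∈ c') → c ⊆ c' := by
    intro c c' hpos h h' hsub x hx
    obtain ⟨i, hi⟩ := exists_pair (hpos x hx)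
    by_cases hir : i + 1 ∈ r
    · have h1 := h.mem i hir
      have h2 := h'.mem i hir
      have h3 := hf i
      have : x = f (i + 1) := by
        by_contra hne
        refine h1.2 ?_
        rcases hi with rfl | rfl <;> rcases h3 with e | e <;> rw [e] at h1 hne <;>
          simp_all
      exact this ▸ h2.1
    · rcases hi with rfl | rfl
      · exact (h'.iff i hir).2 (hsub i hir ((h.iff i hir).1 hx))
      · exact hsub i hir hx
  by_cases hs : ∀ i, i + 1 ∉ r → 2 * i + 2 ∈ c → 2 * i + 2 ∈ c'
  · exact Or.inl (key hpos h h' hs)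
  · push Not at hs
    obtain ⟨j, hjr, hjc, hjc'⟩ := hs
    refine Or.inr (key hpos' h' h fun i hir hic' => ?_)
    rcases lt_trichotomy i j with hij | rfl | hij
    · exact h.lower i j hij hir hjr hjc
    · exact hjc
    · exact absurd (h'.lower j i hij hjr hir hic') hjc'

theorem PairPattern.eq_of_length_eq {f : ℕ → ℕ} (hf : IsSelector f) {r c c' : List ℕ}
    (hpos : ∀ x ∈ c, 1 ≤ x) (hpos' : ∀ x ∈ c', 1 ≤ x) (hc : c.Pairwise (· < ·))
    (hc' : c'.Pairwise (· < ·)) (h : PairPattern f r c) (h' : PairPattern f r c')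
    (hl : c.length = c'.length) : c = c' := by
  have key : ∀ {a b : List ℕ}, a.Pairwise (· < ·) → b.Pairwise (· < ·) → a.length = b.length →
      a ⊆ b → a = b := by
    intro a b ha hb hab hsub
    have hsp : a.Subperm b := List.subperm_of_subset (ha.imp fun h => h.ne) hsub
    have hp := hsp.perm_of_length_le hab.ge
    exact List.Pairwise.eq_of_mem_iff ha hb fun x => hp.mem_iff
  rcases h.subset_or_subset hf hpos hpos' h' with hs | hs
  · exact key hc hc' hl hs
  · exact (key hc' hc hl.symm hs).symm

/-- No entry is removed from a column that meets each pair at most once. -/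
theorem red_map_eq_self {f : ℕ → ℕ} (hf : IsSelector f) {r : List ℕ}
    (hr : ∀ k ∈ r, 1 ≤ k) (hs : r.Pairwise (· < ·)) : red (r.map f) = r.map f := by
  have hi : ∀ i x, x = 2 * i + 1 ∨ x = 2 * i + 2 → x ∈ r.map f → i + 1 ∈ r ∧ x = f (i + 1) :=
    fun i x hx h => (hf.mem_map_iff hr hx).1 h
  refine PairPattern.red_eq hf hr hs (hf.pairwise_map hr hs) (fun x hx => ?_)
    ⟨fun i hir => ⟨List.mem_map.2 ⟨_, hir, rfl⟩, fun h => ?_⟩, fun i hir => ?_,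
      fun i j _ _ hjr hj => absurd (hi j _ (Or.inr rfl) hj).1 hjr⟩
  · obtain ⟨k, hk, rfl⟩ := List.mem_map.1 hx
    obtain ⟨k, rfl⟩ := Nat.exists_eq_add_of_le' (hr k hk)
    have := hf k
    omega
  · have h1 := (hi i _ (Or.inl rfl) h.1).2
    have h2 := (hi i _ (Or.inr rfl) h.2).2
    omega
  · exact ⟨fun h => absurd (hi i _ (Or.inl rfl) h).1 hir,
      fun h => absurd (hi i _ (Or.inr rfl) h).1 hir⟩

/-! ### The explicit column -/

/-- The column `expandCol (r.map f) (fill (gaps (r.map f)) (2 * q))` in recursive form, for the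
pairs after the first `s`: the first `q` pairs not numbered by `r` are filled, and the entry
`f k` is added for each `k ∈ r`. -/
def pairFill (f : ℕ → ℕ) : ℕ → List ℕ → ℕ → List ℕ
  | s, [], q => List.range' (2 * s + 1) (2 * q)
  | s, k :: r, q =>
    List.range' (2 * s + 1) (2 * min (k - 1 - s) q) ++
      f k :: pairFill f k r (q - min (k - 1 - s) q)

theorem add_length_le_of_pairwise {a m : ℕ} {r : List ℕ} (h : (a :: r).Pairwise (· < ·))
    (ha : a ≤ m) (hm : ∀ k ∈ r, k ≤ m) : a + r.length ≤ m := by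
  induction r generalizing a with
  | nil => simpa using ha
  | cons k r ih =>
    rw [List.pairwise_cons] at h
    have h1 := ih h.2 (hm k (by simp)) fun x hx => hm x (by simp [hx])
    have h2 := h.1 k (by simp)
    rw [List.length_cons]
    omega

/-! ### The lengths of the blocks -/

theorem sum_fill (g : List ℕ) (m : ℕ) : (fill g m).sum = m := by
  induction g generalizing m with
  | nil => simp [fill]
  | cons a g ih =>
    rw [fill, List.sum_cons, ih]
    omega

theorem even_of_mem_fill {g : List ℕ} {m : ℕ} (hg : ∀ x ∈ g, Even x) (hm : Even m) {x : ℕ}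
    (hx : x ∈ fill g m) : Even x := by
  induction g generalizing m with
  | nil =>
    simp only [fill, List.mem_singleton] at hx
    exact hx ▸ hm
  | cons a g ih =>
    have ha : Even (min a m) := by
      rcases min_choice a m with h | h <;> rw [h]
      · exact hg a (by simp)
      · exact hm
    rw [fill, List.mem_cons] at hx
    rcases hx with rfl | hx
    · exact ha
    · exact ih (fun y hy => hg y (by simp [hy])) (hm.tsub ha) hx

theorem fill_of_sum_le {g : List ℕ} {m : ℕ} (h : g.sum ≤ m) : fill g m = g ++ [m - g.sum] := by
  induction g generalizing m with
  | nil => simp [fill]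
  | cons a g ih =>
    rw [List.sum_cons] at h
    rw [fill, min_eq_left (by omega), ih (by omega), List.sum_cons, Nat.sub_sub]
    rfl

theorem IsSelector.firstGap_eq {f : ℕ → ℕ} (hf : IsSelector f) {k : ℕ} (hk : 1 ≤ k) :
    firstGap (f k) = 2 * (k - 1) := by
  obtain ⟨k, rfl⟩ := Nat.exists_eq_add_of_le' hk
  have := hf k
  simp only [firstGap, Nat.even_iff]
  split_ifs <;> omega

theorem IsSelector.nextGap_eq {f : ℕ → ℕ} (hf : IsSelector f) {j k : ℕ} (hj : 1 ≤ j)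
    (hjk : j < k) : nextGap (f j) (f k) = 2 * (k - 1 - j) := by
  obtain ⟨j, rfl⟩ := Nat.exists_eq_add_of_le' hj
  obtain ⟨k, rfl⟩ := Nat.exists_eq_add_of_le' (hj.trans hjk.le)
  have h1 := hf j
  have h2 := hf k
  simp only [nextGap, Nat.even_iff]
  split_ifs <;> omega

theorem IsSelector.block_eq {f : ℕ → ℕ} (hf : IsSelector f) {k : ℕ} (hk : 1 ≤ k) (m : ℕ) :
    block (f k) m = f k :: List.range' (2 * k + 1) m := by
  obtain ⟨k, rfl⟩ := Nat.exists_eq_add_of_le' hk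
  simp only [block, Nat.even_iff]
  split_ifs
  · rw [show f (k + 1) + 1 = 2 * (k + 1) + 1 by have := hf k; omega]
  · rw [show f (k + 1) + 2 = 2 * (k + 1) + 1 by have := hf k; omega]

theorem IsSelector.even_of_mem_gaps {f : ℕ → ℕ} (hf : IsSelector f) {r : List ℕ}
    (hr : (0 :: r).Pairwise (· < ·)) {x : ℕ} (hx : x ∈ gaps (r.map f)) : Even x := by
  cases r with
  | nil => simp [gaps] at hx
  | cons k r =>
    have hk : 1 ≤ k := (List.pairwise_cons.1 hr).1 k (by simp)
    replace hr := (List.pairwise_cons.1 hr).2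
    rw [List.map_cons, gaps, List.mem_cons] at hx
    rcases hx with rfl | hx
    · rw [hf.firstGap_eq hk]
      exact even_two_mul _
    · induction r generalizing k with
      | nil => simp at hx
      | cons j r ih =>
        rw [List.pairwise_cons] at hr
        have hj := hr.1 j (by simp)
        rw [List.map_cons, List.zipWith_cons_cons, List.mem_cons] at hx
        rcases hx with rfl | hx
        · rw [hf.nextGap_eq hk hj]
          exact even_two_mul _
        · exact ih j (by omega) hr.2 hx

theorem flatten_zipWith_block {f : ℕ → ℕ} (hf : IsSelector f) {k : ℕ} {r : List ℕ} (hk : 1 ≤ k)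
    (hr : (k :: r).Pairwise (· < ·)) (q : ℕ) :
    (List.zipWith block (f k :: r.map f)
      (fill (List.zipWith nextGap (f k :: r.map f) (r.map f)) (2 * q))).flatten =
      f k :: pairFill f k r q := by
  induction r generalizing k q with
  | nil => simp [fill, pairFill, hf.block_eq hk]
  | cons j r ih =>
    rw [List.pairwise_cons] at hr
    have hj := hr.1 j (by simp)
    rw [List.map_cons, List.zipWith_cons_cons, fill, List.zipWith_cons_cons, List.flatten_cons,
      hf.nextGap_eq hk hj, Nat.mul_min_mul_left, ← Nat.mul_sub, ih (by omega) hr.2, pairFill,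
      hf.block_eq hk]
    rfl

theorem expandCol_eq_pairFill {f : ℕ → ℕ} (hf : IsSelector f) {r : List ℕ}
    (hr : (0 :: r).Pairwise (· < ·)) (q : ℕ) :
    expandCol (r.map f) (fill (gaps (r.map f)) (2 * q)) = pairFill f 0 r q := by
  cases r with
  | nil => simp [gaps, fill, expandCol, pairFill]
  | cons k r =>
    have hk : 1 ≤ k := (List.pairwise_cons.1 hr).1 k (by simp)
    rw [List.map_cons, gaps, fill, expandCol, hf.firstGap_eq hk, Nat.mul_min_mul_left,
      ← Nat.mul_sub, flatten_zipWith_block hf hk (List.pairwise_cons.1 hr).2, pairFill]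
    rfl

/-! ### The entries of the explicit column -/

theorem pairFill_zero (f : ℕ → ℕ) (s : ℕ) (r : List ℕ) : pairFill f s r 0 = r.map f := by
  induction r generalizing s with
  | nil => simp [pairFill]
  | cons k r ih => simp [pairFill, ih]

theorem mem_pairFill_cons {f : ℕ → ℕ} {s k q x : ℕ} {r : List ℕ} :
    x ∈ pairFill f s (k :: r) q ↔ (2 * s + 1 ≤ x ∧ x < 2 * s + 1 + 2 * min (k - 1 - s) q) ∨
      x = f k ∨ x ∈ pairFill f k r (q - min (k - 1 - s) q) := by
  simp [pairFill, List.mem_range'_1]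

theorem length_pairFill {f : ℕ → ℕ} (s : ℕ) (r : List ℕ) (q : ℕ) :
    (pairFill f s r q).length = r.length + 2 * q := by
  induction r generalizing s q with
  | nil => simp [pairFill]
  | cons k r ih =>
    simp only [pairFill, List.length_append, List.length_range', List.length_cons, ih]
    omega

theorem le_of_mem_pairFill {f : ℕ → ℕ} (hf : IsSelector f) {s q : ℕ} {r : List ℕ}
    (hr : (s :: r).Pairwise (· < ·)) {x : ℕ} (hx : x ∈ pairFill f s r q) : 2 * s + 1 ≤ x := by
  induction r generalizing s q with
  | nil =>
    simp [pairFill, List.mem_range'_1] at hx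
    omega
  | cons k r ih =>
    rw [List.pairwise_cons] at hr
    have hk := hr.1 k (by simp)
    rcases mem_pairFill_cons.1 hx with h | rfl | h
    · exact h.1
    · have := hf (k - 1)
      rw [Nat.sub_add_cancel (by omega)] at this
      omega
    · have := ih hr.2 h
      omega

theorem mem_pairFill_le {f : ℕ → ℕ} (hf : IsSelector f) {s q n : ℕ} {r : List ℕ}
    (hr : (s :: r).Pairwise (· < ·)) (hn : ∀ k ∈ r, k ≤ n) (hq : s + r.length + q ≤ n) {x : ℕ}
    (hx : x ∈ pairFill f s r q) : x ≤ 2 * n := by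
  induction r generalizing s q with
  | nil =>
    simp [pairFill, List.mem_range'_1] at hx hq
    omega
  | cons k r ih =>
    rw [List.pairwise_cons] at hr
    have hk := hr.1 k (by simp)
    have hkn := hn k (by simp)
    have hn' : ∀ j ∈ r, j ≤ n := fun j hj => hn j (by simp [hj])
    have h1 := add_length_le_of_pairwise hr.2 hkn hn'
    rw [List.length_cons] at hq
    rcases mem_pairFill_cons.1 hx with h | rfl | h
    · omega
    · have := hf (k - 1)
      rw [Nat.sub_add_cancel (by omega)] at this
      omega
    · exact ih hr.2 hn' (by omega) h

theorem pairwise_pairFill {f : ℕ → ℕ} (hf : IsSelector f) {s q : ℕ} {r : List ℕ}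
    (hr : (s :: r).Pairwise (· < ·)) : (pairFill f s r q).Pairwise (· < ·) := by
  induction r generalizing s q with
  | nil => simpa [pairFill] using List.pairwise_lt_range'
  | cons k r ih =>
    rw [List.pairwise_cons] at hr
    have hk := hr.1 k (by simp)
    have hfk := hf (k - 1)
    rw [Nat.sub_add_cancel (by omega)] at hfk
    rw [pairFill, List.pairwise_append, List.pairwise_cons]
    refine ⟨List.pairwise_lt_range', ⟨fun x hx => ?_, ih hr.2⟩, fun a ha b hb => ?_⟩
    · have := le_of_mem_pairFill hf hr.2 hx
      omega
    · simp only [List.mem_range'_1] at ha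
      rcases List.mem_cons.1 hb with rfl | hb
      · omega
      · have := le_of_mem_pairFill hf hr.2 hb
        omega

/-- The pattern of the explicit column from pair number `s + 1` on, in the form needed for the
induction on `r`. -/
theorem pairFill_pattern {f : ℕ → ℕ} (hf : IsSelector f) {s : ℕ} {r : List ℕ}
    (hr : (s :: r).Pairwise (· < ·)) (q : ℕ) :
    (∀ i, i + 1 ∈ r → f (i + 1) ∈ pairFill f s r q ∧
      ¬ (2 * i + 1 ∈ pairFill f s r q ∧ 2 * i + 2 ∈ pairFill f s r q)) ∧
    (∀ i, s ≤ i → i + 1 ∉ r → (2 * i + 1 ∈ pairFill f s r q ↔ 2 * i + 2 ∈ pairFill f s r q)) ∧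
    ∀ i j, s ≤ i → i < j → i + 1 ∉ r → j + 1 ∉ r → 2 * j + 2 ∈ pairFill f s r q →
      2 * i + 2 ∈ pairFill f s r q := by
  induction r generalizing s q with
  | nil =>
    simp only [pairFill, List.mem_range'_1, List.not_mem_nil, false_imp_iff, true_and,
      not_false_eq_true, true_imp_iff, imp_true_iff]
    refine ⟨fun i hi => ?_, fun i j hi hij hj => ?_⟩ <;> omega
  | cons k r ih =>
    rw [List.pairwise_cons] at hr
    have hk := hr.1 k (by simp)
    have hfk := hf (k - 1)
    rw [Nat.sub_add_cancel (by omega)] at hfk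
    set g := min (k - 1 - s) q with hg
    obtain ⟨h1, h2, h3⟩ := ih hr.2 (q - g)
    have hge : ∀ x ∈ pairFill f k r (q - g), 2 * k + 1 ≤ x := fun x hx =>
      le_of_mem_pairFill hf hr.2 hx
    have hbefore : ∀ i x, x = 2 * i + 1 ∨ x = 2 * i + 2 → s ≤ i → i + 1 < k →
        (x ∈ pairFill f s (k :: r) q ↔ i < s + g) := by
      intro i x hx hsi hik
      rw [mem_pairFill_cons, ← hg]
      refine ⟨fun h => ?_, fun h => Or.inl (by omega)⟩
      rcases h with h | h | h
      · omega
      · omega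
      · have := hge x h
        omega
    have hafter : ∀ i x, x = 2 * i + 1 ∨ x = 2 * i + 2 → k ≤ i →
        (x ∈ pairFill f s (k :: r) q ↔ x ∈ pairFill f k r (q - g)) := by
      intro i x hx hik
      rw [mem_pairFill_cons, ← hg]
      refine ⟨fun h => ?_, fun h => Or.inr (Or.inr h)⟩
      rcases h with h | h | h
      · omega
      · omega
      · exact h
    refine ⟨fun i hi => ?_, fun i hsi hi => ?_, fun i j hsi hij hi hj hjm => ?_⟩
    · rcases List.mem_cons.1 hi with rfl | hi
      · refine ⟨mem_pairFill_cons.2 (Or.inr (Or.inl rfl)), ?_⟩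
        rintro ⟨ha, hb⟩
        have hx : ∀ x, x ∈ pairFill f s ((i + 1) :: r) q → x ≤ 2 * i + 2 → 2 * i + 1 ≤ x →
            x = f (i + 1) := by
          intro x hx _ _
          rcases mem_pairFill_cons.1 hx with h | h | h
          · omega
          · exact h
          · have := hge x h
            omega
        have ha := hx _ ha (by omega) (by omega)
        have hb := hx _ hb (by omega) (by omega)
        omega
      · have hki := (List.pairwise_cons.1 hr.2).1 _ hi
        obtain ⟨ha, hb⟩ := h1 i hi
        rw [hafter i _ (Or.inl rfl) (by omega), hafter i _ (Or.inr rfl) (by omega)]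
        exact ⟨mem_pairFill_cons.2 (Or.inr (Or.inr ha)), hb⟩
    · simp only [List.mem_cons, not_or] at hi
      rcases lt_or_gt_of_ne hi.1 with h | h
      · rw [hbefore i _ (Or.inl rfl) hsi h, hbefore i _ (Or.inr rfl) hsi h]
      · rw [hafter i _ (Or.inl rfl) (by omega), hafter i _ (Or.inr rfl) (by omega)]
        exact h2 i (by omega) hi.2
    · simp only [List.mem_cons, not_or] at hi hj
      rcases lt_or_gt_of_ne hi.1 with h | h
      · rw [hbefore i _ (Or.inr rfl) hsi h]
        rcases lt_or_gt_of_ne hj.1 with h' | h'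
        · rw [hbefore j _ (Or.inr rfl) (by omega) h'] at hjm
          omega
        · rw [hafter j _ (Or.inr rfl) (by omega)] at hjm
          by_contra hn
          -- If the pairs before `k` are not all filled, then none is filled after `k`.
          rw [show q - g = 0 by omega, pairFill_zero, hf.mem_map_iff (fun y hy => ?_)
            (Or.inr rfl)] at hjm
          · exact hj.2 hjm.1
          · have := (List.pairwise_cons.1 hr.2).1 y hy
            omega
      · rw [hafter i _ (Or.inr rfl) (by omega)]
        rw [hafter j _ (Or.inr rfl) (by omega)] at hjm
        exact h3 i j (by omega) hij hi.2 hj.2 hjm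

theorem pairPattern_pairFill {f : ℕ → ℕ} (hf : IsSelector f) {r : List ℕ}
    (hr : (0 :: r).Pairwise (· < ·)) (q : ℕ) : PairPattern f r (pairFill f 0 r q) := by
  obtain ⟨h1, h2, h3⟩ := pairFill_pattern hf hr q
  exact ⟨h1, fun i => h2 i (Nat.zero_le i), fun i j => h3 i j (Nat.zero_le i)⟩

/-- The row inequality between the explicit column and the rows of the tableau next to it. The
number `e` counts by how much the position in the column is ahead of the current pair. -/
theorem getD_pairFill_le {f : ℕ → ℕ} (hf : IsSelector f) {s q e m : ℕ} {r : List ℕ}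
    (hr : (s :: r).Pairwise (· < ·)) (hm : ∀ k ∈ r, k ≤ m) (hq : m ≤ s + r.length + 2 * q + e)
    {i : ℕ} (hi : s + e + i + 1 ≤ m) : (pairFill f s r q).getD i 0 ≤ f (s + e + i + 1) := by
  induction r generalizing s q e i with
  | nil =>
    have := hf (s + e + i)
    rw [pairFill, List.getD_eq_getElem?_getD]
    rcases lt_or_ge i (2 * q) with h | h
    · rw [List.getElem?_range' h]
      simp
      omega
    · simp [h]
  | cons k r ih =>
    rw [List.pairwise_cons] at hr
    have hk := hr.1 k (by simp)
    have hkm := hm k (by simp)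
    have hm' : ∀ j ∈ r, j ≤ m := fun j hj => hm j (by simp [hj])
    have h1 := add_length_le_of_pairwise hr.2 hkm hm'
    have hfi := hf (s + e + i)
    rw [List.length_cons] at hq
    rw [pairFill]
    set g := min (k - 1 - s) q with hg
    have hkg : k ≤ s + e + 2 * g + 1 := by omega
    rcases lt_trichotomy i (2 * g) with h | rfl | h
    · rw [List.getD_append _ _ _ _ (by simpa using h), List.getD_eq_getElem?_getD,
        List.getElem?_range' h]
      simp
      omega
    · rw [List.getD_append_right _ _ _ _ (by simp)]
      simp only [List.length_range', Nat.sub_self, List.getD_cons_zero]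
      have := hf.strictMono.monotone (show k - 1 ≤ s + e + 2 * g by omega)
      simpa only [Nat.sub_add_cancel (show 1 ≤ k by omega)] using this
    · obtain ⟨i, rfl⟩ := Nat.exists_eq_add_of_lt h
      rw [List.getD_append_right _ _ _ _ (by simp; omega)]
      have h2 := ih (s := k) (q := q - g) (e := s + e + 2 * g + 1 - k) (i := i) hr.2 hm'
        (by omega) (by omega)
      rw [show k + (s + e + 2 * g + 1 - k) + i + 1 = s + e + (2 * g + i + 1) + 1 by omega] at h2
      rwa [List.length_range', show 2 * g + i + 1 - 2 * g = i + 1 by omega, List.getD_cons_succ]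

/-! ### Removing the first column of a diagram -/

theorem shift_injective : Function.Injective fun c : ℕ × ℕ => (c.1, c.2 + 1) := by
  rintro ⟨a, b⟩ ⟨c, d⟩ h
  simpa using h

/-- The diagram `lam` without its first column. -/
noncomputable def dropCol (lam : YoungDiagram) : YoungDiagram where
  cells := lam.cells.preimage (fun c => (c.1, c.2 + 1)) shift_injective.injOn
  isLowerSet := by
    rintro ⟨a, b⟩ ⟨c, d⟩ ⟨hca, hdb⟩ h
    rw [Finset.mem_coe, Finset.mem_preimage, YoungDiagram.mem_cells] at h ⊢
    exact lam.up_left_mem hca (Nat.succ_le_succ hdb) h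

theorem mem_dropCol {lam : YoungDiagram} {i j : ℕ} :
    (i, j) ∈ dropCol lam ↔ (i, j + 1) ∈ lam := by
  rw [← YoungDiagram.mem_cells, dropCol, Finset.mem_preimage, YoungDiagram.mem_cells]

theorem rowLen_dropCol (lam : YoungDiagram) (i : ℕ) :
    (dropCol lam).rowLen i = lam.rowLen i - 1 := by
  refine eq_of_forall_lt_iff fun j => ?_
  rw [← YoungDiagram.mem_iff_lt_rowLen, mem_dropCol, YoungDiagram.mem_iff_lt_rowLen]
  omega

theorem colLen_dropCol (lam : YoungDiagram) (j : ℕ) :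
    (dropCol lam).colLen j = lam.colLen (j + 1) := by
  refine eq_of_forall_lt_iff fun i => ?_
  rw [← YoungDiagram.mem_iff_lt_colLen, mem_dropCol, YoungDiagram.mem_iff_lt_colLen]

theorem lt_colLen_zero_iff {lam : YoungDiagram} {i : ℕ} :
    i < lam.colLen 0 ↔ 0 < lam.rowLen i := by
  rw [← YoungDiagram.mem_iff_lt_colLen, YoungDiagram.mem_iff_lt_rowLen]

/-! ### Tableaux as lists of columns -/

/-- The columns of the filling `g` of `lam`. -/
def colsOf (lam : YoungDiagram) (g : ℕ → ℕ → ℕ) : List (List ℕ) :=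
  (List.range (lam.rowLen 0)).map fun j => (List.range (lam.colLen j)).map fun i => g i j

theorem cols_eq_colsOf {lam : YoungDiagram} (T : SemistandardYoungTableau lam) :
    cols T = colsOf lam T := rfl

theorem colsOf_congr {lam : YoungDiagram} {g h : ℕ → ℕ → ℕ}
    (hgh : ∀ i j, (i, j) ∈ lam → g i j = h i j) : colsOf lam g = colsOf lam h := by
  refine List.map_congr_left fun j _ => List.map_congr_left fun i hi => hgh i j ?_
  rw [YoungDiagram.mem_iff_lt_colLen]
  exact List.mem_range.1 hi

theorem colsOf_eq_nil {lam : YoungDiagram} (h : lam.rowLen 0 = 0) (g : ℕ → ℕ → ℕ) :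
    colsOf lam g = [] := by
  simp [colsOf, h]

theorem colsOf_eq_cons {lam : YoungDiagram} (h : lam.rowLen 0 ≠ 0) (g : ℕ → ℕ → ℕ) :
    colsOf lam g = ((List.range (lam.colLen 0)).map fun i => g i 0) ::
      colsOf (dropCol lam) fun i j => g i (j + 1) := by
  obtain ⟨w, hw⟩ := Nat.exists_eq_succ_of_ne_zero h
  simp only [colsOf, hw, rowLen_dropCol, colLen_dropCol, List.range_succ_eq_map,
    Nat.succ_sub_one]
  simp [Function.comp_def]

/-- For the empty diagram, both sides are the empty tableau. -/
theorem suc_colsOf (lam : YoungDiagram) (g : ℕ → ℕ → ℕ) :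
    suc (colsOf lam g) = colMul (red ((List.range (lam.colLen 0)).map fun i => g i 0))
      (colsOf (dropCol lam) fun i j => g i (j + 1)) := by
  by_cases h : lam.rowLen 0 = 0
  · have h0 : lam.colLen 0 = 0 := by
      by_contra h'
      have := lt_colLen_zero_iff.1 (Nat.pos_of_ne_zero h')
      omega
    rw [colsOf_eq_nil h, h0, colsOf_eq_nil (by rw [rowLen_dropCol, h])]
    rfl
  · rw [colsOf_eq_cons h, suc]

theorem map_length_colsOf (lam : YoungDiagram) (g : ℕ → ℕ → ℕ) :
    (colsOf lam g).map List.length = (List.range (lam.rowLen 0)).map lam.colLen := by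
  simp [colsOf, Function.comp_def]

theorem inShape_colsOf {lam : YoungDiagram} {g : ℕ → ℕ → ℕ} {i j : ℕ} :
    InShape (colsOf lam g) i j ↔ (i, j) ∈ lam := by
  rw [InShape, List.getD_eq_getElem?_getD, colsOf, List.getElem?_map]
  by_cases h : j < lam.rowLen 0
  · rw [List.getElem?_range h, YoungDiagram.mem_iff_lt_colLen]
    simp
  · rw [List.getElem?_eq_none (by simpa using h), YoungDiagram.mem_iff_lt_rowLen]
    have := lam.rowLen_anti 0 i (Nat.zero_le i)
    simp
    omega

theorem getD_map_range {g : ℕ → ℕ} {m i : ℕ} (h : i < m) :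
    ((List.range m).map g).getD i 0 = g i := by
  simp [List.getD_eq_getElem?_getD, h]

theorem colsOf_semistd {lam : YoungDiagram} {g : ℕ → ℕ → ℕ}
    (hrow : ∀ i j, (i, j + 1) ∈ lam → g i j ≤ g i (j + 1))
    (hcol : ∀ i₁ i₂ j, i₁ < i₂ → (i₂, j) ∈ lam → g i₁ j < g i₂ j) : IsSemistd (colsOf lam g) := by
  induction hw : lam.rowLen 0 generalizing lam g with
  | zero => rw [colsOf_eq_nil hw]; trivial
  | succ w ih =>
    have h := colsOf_eq_cons (lam := lam) (by omega) g
    have hlen : 0 < lam.colLen 0 := lt_colLen_zero_iff.2 (by omega)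
    rw [h]
    refine ⟨by simp; omega, ?_, ?_, ?_⟩
    · rw [List.pairwise_map]
      refine List.pairwise_lt_range.imp_of_mem fun {a b} _ hb hab => hcol a b 0 hab ?_
      rw [YoungDiagram.mem_iff_lt_colLen]
      exact List.mem_range.1 hb
    · by_cases h0 : (dropCol lam).rowLen 0 = 0
      · rw [colsOf_eq_nil h0]
        exact ColLE.nil _
      · rw [colsOf_eq_cons h0, List.headD_cons]
        have hle : (dropCol lam).colLen 0 ≤ lam.colLen 0 := by
          rw [colLen_dropCol]
          exact lam.colLen_anti 0 1 (by omega)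
        refine ⟨by simpa using hle, fun i hi => ?_⟩
        simp only [List.length_map, List.length_range] at hi
        rw [getD_map_range (hi.trans_le hle), getD_map_range hi]
        exact hrow i 0 (mem_dropCol.1 (YoungDiagram.mem_iff_lt_colLen.2 hi))
    · exact ih (fun i j hij => hrow i (j + 1) (mem_dropCol.1 hij))
        (fun i₁ i₂ j h hij => hcol i₁ i₂ (j + 1) h (mem_dropCol.1 hij))
        (by rw [rowLen_dropCol, hw]; rfl)

theorem cols_semistd {lam : YoungDiagram} (T : SemistandardYoungTableau lam) :
    IsSemistd (cols T) :=
  colsOf_semistd (fun _ _ h => T.row_weak (Nat.lt_succ_self _) h)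
    fun _ _ _ h h' => T.col_strict h h'

theorem colsOf_pairwise {lam : YoungDiagram} {g : ℕ → ℕ → ℕ} (h : IsSemistd (colsOf lam g)) :
    ∀ t ∈ colsOf lam g, t.Pairwise (· < ·) := by
  have : ∀ T : List (List ℕ), IsSemistd T → ∀ t ∈ T, t.Pairwise (· < ·) := by
    intro T
    induction T with
    | nil => simp
    | cons c T ih =>
      intro hT t ht
      rcases List.mem_cons.1 ht with rfl | ht
      · exact hT.2.1
      · exact ih hT.2.2.2 t ht
  exact this _ h

theorem eq_of_colsOf_eq {lam : YoungDiagram} {g h : ℕ → ℕ → ℕ} (hgh : colsOf lam g = colsOf lam h)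
    {i j : ℕ} (hij : (i, j) ∈ lam) : g i j = h i j := by
  have hj : j < lam.rowLen 0 := (YoungDiagram.mem_iff_lt_rowLen.1 hij).trans_le
    (lam.rowLen_anti 0 i (Nat.zero_le i))
  have h1 := List.map_inj_left.1 hgh j (List.mem_range.2 hj)
  exact List.map_inj_left.1 h1 i (List.mem_range.2 (YoungDiagram.mem_iff_lt_colLen.1 hij))

/-! ### Inserting a column into a tableau with constant rows -/

theorem cols_rowConst {f : ℕ → ℕ} (hf : StrictMono fun i => f (i + 1)) (mu : YoungDiagram) :
    cols (rowConst (fun i => f (i + 1)) hf mu) = colsOf mu fun i _ => f (i + 1) :=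
  colsOf_congr fun _ _ h => if_pos h

theorem map_range_succ (f : ℕ → ℕ) (m : ℕ) :
    ((List.range m).map fun i => f (i + 1)) = (List.range' 1 m).map f := by
  rw [List.range'_eq_map_range, List.map_map]
  exact List.map_congr_left fun i _ => by simp [add_comm]

theorem merge_map {f : ℕ → ℕ} {d t : List ℕ} (h : ∀ x ∈ d, ∀ y ∈ t, f x ≤ f y ↔ x ≤ y) :
    merge (d.map f) (t.map f) = ((merge d t).1.map f, (merge d t).2.map f) := by
  induction t generalizing d with
  | nil => simp [merge_nil_right]
  | cons y t ih =>
    cases d with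
    | nil => simp [merge_nil_left]
    | cons x d =>
      have hxy := h x (by simp) y (by simp)
      have h1 := ih (d := d) fun a ha b hb => h a (by simp [ha]) b (by simp [hb])
      have h2 := ih (d := x :: d) fun a ha b hb => h a ha b (by simp [hb])
      rw [List.map_cons] at h2
      simp only [List.map_cons, merge, hxy]
      split_ifs <;> simp [h1, h2]

theorem merge_range' {a m : ℕ} {r : List ℕ} (hr : r.Pairwise (· < ·)) (ha : ∀ k ∈ r, a ≤ k) :
    merge r (List.range' a m) =
      (List.range' a m ++ r.filter (a + m ≤ ·), r.filter (· < a + m)) := by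
  induction m generalizing a r with
  | zero =>
    have h1 : r.filter (a + 0 ≤ ·) = r := List.filter_eq_self.2 (by simpa using ha)
    have h2 : r.filter (· < a + 0) = [] := by
      rw [List.filter_eq_nil_iff]
      simpa using ha
    rw [h1, h2]
    simp [merge_nil_right]
  | succ m ih =>
    rw [List.range'_succ]
    cases r with
    | nil => simp [merge_nil_left]
    | cons x r =>
      have hr' := List.pairwise_cons.1 hr
      have hx := ha x (by simp)
      by_cases hxa : x ≤ a
      · obtain rfl : x = a := le_antisymm hxa hx
        rw [merge_cons_of_le le_rfl, ih hr'.2 fun k hk => hr'.1 k hk]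
        have e : x + 1 + m = x + (m + 1) := by omega
        simp [e]
      · have h1 : ∀ k ∈ x :: r, a < k := by
          intro k hk
          rcases List.mem_cons.1 hk with rfl | hk
          · omega
          · have := hr'.1 k hk
            omega
        rw [merge_cons_of_forall_lt h1, ih hr fun k hk => h1 k hk,
          show a + 1 + m = a + (m + 1) by omega]
        rfl

/-- Inserting the column `f k`, `k ∈ r`, into a tableau with constant rows appends one cell to each
row numbered by `r`. -/
theorem colMul_map_colsOf {f : ℕ → ℕ} (hf : IsSelector f) {mu' mu : YoungDiagram} {r : List ℕ}
    (hr : (0 :: r).Pairwise (· < ·))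
    (h : ∀ i, mu'.rowLen i + (if i + 1 ∈ r then 1 else 0) = mu.rowLen i) :
    colMul (r.map f) (colsOf mu' fun i _ => f (i + 1)) = colsOf mu fun i _ => f (i + 1) := by
  have hcol : ∀ {mu' mu : YoungDiagram} {r : List ℕ}, (0 :: r).Pairwise (· < ·) →
      (∀ i, mu'.rowLen i + (if i + 1 ∈ r then 1 else 0) = mu.rowLen i) →
      List.range' 1 (mu'.colLen 0) ++ r.filter (1 + mu'.colLen 0 ≤ ·) =
        List.range' 1 (mu.colLen 0) := by
    intro mu' mu r hr h
    rw [List.pairwise_cons] at hr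
    refine List.Pairwise.eq_of_mem_iff (r := (· < ·)) ?_ List.pairwise_lt_range' fun x => ?_
    · rw [List.pairwise_append]
      refine ⟨List.pairwise_lt_range', hr.2.sublist List.filter_sublist, fun a ha b hb => ?_⟩
      simp [List.mem_range'_1] at ha hb
      omega
    · simp only [List.mem_append, List.mem_range'_1, List.mem_filter, decide_eq_true_eq]
      cases x with
      | zero => simp
      | succ i =>
        have h1 := h i
        have h2 := lt_colLen_zero_iff (lam := mu) (i := i)
        have h3 := lt_colLen_zero_iff (lam := mu') (i := i)
        split_ifs at h1 with h4
        · simp only [h4, true_and]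
          omega
        · simp only [h4, false_and, or_false]
          omega
  induction hw : mu'.rowLen 0 generalizing mu' mu r with
  | zero =>
    have h0 : ∀ i, mu'.rowLen i = 0 := fun i => by
      have := mu'.rowLen_anti 0 i (Nat.zero_le i)
      omega
    have hc0 : mu'.colLen 0 = 0 := by
      by_contra h'
      have := lt_colLen_zero_iff.1 (Nat.pos_of_ne_zero h')
      omega
    have hr1 : r = List.range' 1 (mu.colLen 0) := by
      rw [← hcol hr h, hc0, List.filter_eq_self.2]
      · simp
      · simpa [Nat.one_le_iff_ne_zero, Nat.pos_iff_ne_zero] using (List.pairwise_cons.1 hr).1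
    rw [colsOf_eq_nil hw]
    by_cases hmu : mu.rowLen 0 = 0
    · have : mu.colLen 0 = 0 := by
        by_contra h'
        have := lt_colLen_zero_iff.1 (Nat.pos_of_ne_zero h')
        omega
      rw [colsOf_eq_nil hmu, hr1, this]
      rfl
    · have hd : (dropCol mu).rowLen 0 = 0 := by
        rw [rowLen_dropCol, ← h, h0]
        split_ifs <;> rfl
      have hpos : 0 < mu.colLen 0 := lt_colLen_zero_iff.2 (Nat.pos_of_ne_zero hmu)
      rw [colsOf_eq_cons hmu, colsOf_eq_nil hd, map_range_succ, ← hr1]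
      refine colMul_nil_right (hf.pairwise_map (fun k hk => (List.pairwise_cons.1 hr).1 k hk)
        (List.pairwise_cons.1 hr).2) ?_
      rw [hr1]
      simp
      omega
  | succ w ih =>
    have hmu : mu.rowLen 0 ≠ 0 := by
      have := h 0
      omega
    have hr' := List.pairwise_cons.1 hr
    have hf' : ∀ x ∈ r, ∀ y ∈ List.range' 1 (mu'.colLen 0), f x ≤ f y ↔ x ≤ y := by
      intro x hx y hy
      obtain ⟨x, rfl⟩ := Nat.exists_eq_add_of_le' (show 1 ≤ x from hr'.1 x hx)
      obtain ⟨y, rfl⟩ := Nat.exists_eq_add_of_le' (List.mem_range'_1.1 hy).1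
      rw [hf.strictMono.le_iff_le (a := x) (b := y)]
      omega
    rw [colsOf_eq_cons (by omega), colsOf_eq_cons hmu, map_range_succ, map_range_succ,
      colMul_cons (hf.pairwise_map (fun k hk => hr'.1 k hk) hr'.2), merge_map hf',
      merge_range' hr'.2 fun k hk => hr'.1 k hk]
    dsimp only
    rw [hcol hr h, ih (mu' := dropCol mu') (mu := dropCol mu) _ _ (by rw [rowLen_dropCol, hw]; rfl)]
    · rw [List.pairwise_cons]
      exact ⟨fun a ha => hr'.1 a (List.mem_filter.1 ha).1, hr'.2.sublist List.filter_sublist⟩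
    · intro i
      have h1 := h i
      have h2 := lt_colLen_zero_iff (lam := mu') (i := i)
      simp only [rowLen_dropCol, List.mem_filter, decide_eq_true_eq]
      by_cases h4 : i + 1 ∈ r
      · simp only [h4, true_and, if_true] at h1 ⊢
        split_ifs <;> omega
      · simp only [h4, false_and, if_false] at h1 ⊢
        omega

/-! ### Contents -/

theorem sum_getD_eq_count (c : List ℕ) (a : ℕ) :
    ∑ i ∈ Finset.range c.length, (if c.getD i 0 = a then 1 else 0) = c.count a := by
  induction c with
  | nil => simp
  | cons x c ih =>
    rw [List.length_cons, Finset.sum_range_succ', List.count_cons]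
    simp only [List.getD_cons_succ, List.getD_cons_zero, ih, beq_iff_eq]

theorem content_of_isConcat {lam : YoungDiagram} {T : SemistandardYoungTableau lam} {c : List ℕ}
    {S : SemistandardYoungTableau (dropCol lam)} (h : IsConcat T c S)
    (hc : c.length = lam.colLen 0) (a : ℕ) : content T a = c.count a + content S a := by
  have hcells : lam.cells = (Finset.range c.length).image (fun i => (i, 0)) ∪
      (dropCol lam).cells.image fun x => (x.1, x.2 + 1) := by
    ext ⟨i, j⟩
    simp only [Finset.mem_union, Finset.mem_image, Finset.mem_range, YoungDiagram.mem_cells,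
      Prod.mk.injEq, Prod.exists, hc]
    cases j with
    | zero => simp [YoungDiagram.mem_iff_lt_colLen]
    | succ j =>
      rw [← mem_dropCol]
      simp
  rw [content, Finset.card_filter, hcells, Finset.sum_union, Finset.sum_image, Finset.sum_image,
    content, Finset.card_filter, ← sum_getD_eq_count]
  · congr 1
    · exact Finset.sum_congr rfl fun i _ => by rw [h.1 i]
    · exact Finset.sum_congr rfl fun x _ => by rw [h.2 x.1 x.2]
  · exact shift_injective.injOn
  · intro i _ i' _ h
    simpa using h
  · rw [Finset.disjoint_left]
    rintro ⟨i, j⟩ h1 h2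
    simp only [Finset.mem_image, Prod.mk.injEq, Prod.exists] at h1 h2
    omega

theorem content_rowConst {f : ℕ → ℕ} (hf : IsSelector f) (mu : YoungDiagram) (i : ℕ) :
    content (rowConst (fun i => f (i + 1)) hf.strictMono mu) (f (i + 1)) = mu.rowLen i := by
  rw [content, YoungDiagram.rowLen_eq_card, YoungDiagram.row]
  congr 1
  refine Finset.filter_congr fun x hx => ?_
  have : (rowConst (fun i => f (i + 1)) hf.strictMono mu) x.1 x.2 = f (x.1 + 1) := if_pos hx
  rw [this]
  exact hf.strictMono.injective.eq_iff (a := x.1) (b := i)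

theorem content_rowConst_eq_zero {f : ℕ → ℕ} (hf : IsSelector f) (mu : YoungDiagram) {a : ℕ}
    (ha : ∀ i, f (i + 1) ≠ a) :
    content (rowConst (fun i => f (i + 1)) hf.strictMono mu) a = 0 := by
  rw [content, Finset.card_eq_zero, Finset.filter_eq_empty_iff]
  intro x hx
  have : (rowConst (fun i => f (i + 1)) hf.strictMono mu) x.1 x.2 = f (x.1 + 1) := if_pos hx
  rw [this]
  exact ha x.1

/-! ### The size of the vertical strip -/

/-- The letters `2 * i - 1` and `2 * i` occur equally often in a Littlewood-Richardson-Sundaram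
tableau. The letter in its lowest row is at least `2 * (lam.colLen 0 - n)` if this row is below
row `n`, and all smaller letters occur as well because the weight is a partition. -/
theorem card_strip {n : ℕ} {lam mu : YoungDiagram} (hmu : mu.colLen 0 ≤ n) {Q : ℕ → ℕ → ℕ}
    (hQ : Q ∈ recTableaux n lam mu) :
    Even (lam.cells \ mu.cells).card ∧
      2 * lam.colLen 0 ≤ 2 * n + (lam.cells \ mu.cells).card := by
  obtain ⟨R, ⟨⟨hR1, -, -, -⟩, -, ⟨hdec, heq⟩, hlow⟩, rfl⟩ := hQ
  have hsum : (lam.cells \ mu.cells).card =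
      ∑ a ∈ Finset.Icc 1 (2 * n), skewContent lam mu R a := by
    refine Finset.card_eq_sum_card_fiberwise fun c hc => ?_
    simp only [Finset.coe_sdiff, Set.mem_sdiff, Finset.mem_coe, YoungDiagram.mem_cells] at hc
    simpa using hR1 c.1 c.2 hc.1 hc.2
  have hdec' : ∀ a b, 1 ≤ a → a ≤ b → skewContent lam mu R b ≤ skewContent lam mu R a := by
    intro a b ha hab
    induction b, hab using Nat.le_induction with
    | base => exact le_rfl
    | succ b hb ih => exact (hdec b (ha.trans hb)).trans ih
  have hpairs : ∀ m, ∑ a ∈ Finset.Icc 1 (2 * m), skewContent lam mu R a =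
      2 * ∑ i ∈ Finset.range m, skewContent lam mu R (2 * i + 1) := by
    intro m
    induction m with
    | zero => simp
    | succ m ih =>
      have h := heq (m + 1) (by omega)
      rw [show 2 * (m + 1) - 1 = 2 * m + 1 by omega] at h
      rw [show 2 * (m + 1) = 2 * m + 1 + 1 by ring, Finset.sum_Icc_succ_top (by omega),
        Finset.sum_Icc_succ_top (by omega), ih, Finset.sum_range_succ,
        show 2 * m + 1 + 1 = 2 * (m + 1) by ring, ← h]
      ring
  refine ⟨?_, ?_⟩
  · rw [hsum, hpairs]
    exact even_two_mul _
  · by_contra hlt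
    obtain ⟨i, hi⟩ : ∃ i, lam.colLen 0 = n + i + 1 := ⟨lam.colLen 0 - n - 1, by omega⟩
    have hmem : (n + i, 0) ∈ lam := by
      rw [YoungDiagram.mem_iff_lt_colLen]
      omega
    have hnmem : (n + i, 0) ∉ mu := by
      rw [YoungDiagram.mem_iff_lt_colLen]
      omega
    have h1 := hlow i hmem
    have h2 := hR1 _ _ hmem hnmem
    have h3 : 1 ≤ skewContent lam mu R (R (n + i) 0) := by
      refine Finset.card_pos.2 ⟨(n + i, 0), ?_⟩
      simp [hmem, hnmem]
    -- All letters up to the entry in the last row occur.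
    have h4 : R (n + i) 0 ≤ (lam.cells \ mu.cells).card := by
      rw [hsum]
      calc R (n + i) 0 = ∑ a ∈ Finset.Icc 1 (R (n + i) 0), 1 := by simp
        _ ≤ ∑ a ∈ Finset.Icc 1 (R (n + i) 0), skewContent lam mu R a := by
          refine Finset.sum_le_sum fun a ha => ?_
          rw [Finset.mem_Icc] at ha
          exact h3.trans (hdec' a _ ha.1 ha.2)
        _ ≤ _ := Finset.sum_le_sum_of_subset (Finset.Icc_subset_Icc_right h2.2)
    omega

/-! ### The rows that contain no cell of the strip -/

theorem mem_slackRows {lam mu : YoungDiagram} {i : ℕ} :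
    i + 1 ∈ slackRows lam mu ↔ i < mu.colLen 0 ∧ lam.rowLen i = mu.rowLen i := by
  simp [slackRows]

theorem slackRows_pairwise (lam mu : YoungDiagram) :
    (0 :: slackRows lam mu).Pairwise (· < ·) := by
  rw [List.pairwise_cons, slackRows, List.pairwise_map]
  refine ⟨fun a ha => ?_, (List.pairwise_lt_range.sublist List.filter_sublist).imp
    fun h => Nat.succ_lt_succ h⟩
  obtain ⟨i, -, rfl⟩ := List.mem_map.1 ha
  exact Nat.succ_pos i

theorem IsVerticalStrip.rowLen_le {lam mu : YoungDiagram} (h : IsVerticalStrip lam mu) (i : ℕ) :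
    mu.rowLen i ≤ lam.rowLen i := by
  refine le_of_forall_lt fun j hj => ?_
  rw [← YoungDiagram.mem_iff_lt_rowLen] at hj ⊢
  exact h.1 hj

theorem IsVerticalStrip.rowLen_dropCol_add {lam mu : YoungDiagram} (h : IsVerticalStrip lam mu)
    (i : ℕ) : (dropCol lam).rowLen i + (if i + 1 ∈ slackRows lam mu then 1 else 0) =
      mu.rowLen i := by
  have h1 := h.rowLen_le i
  have h2 := h.2 i
  have h3 := lt_colLen_zero_iff (lam := mu) (i := i)
  simp only [rowLen_dropCol, mem_slackRows]
  split_ifs <;> omega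

theorem rowLen_eq_dropCol_add (lam : YoungDiagram) (i : ℕ) :
    lam.rowLen i = (dropCol lam).rowLen i + if i < lam.colLen 0 then 1 else 0 := by
  simp only [rowLen_dropCol, lt_colLen_zero_iff]
  split_ifs <;> omega

theorem IsVerticalStrip.colLen_le {lam mu : YoungDiagram} (h : IsVerticalStrip lam mu) :
    mu.colLen 0 ≤ lam.colLen 0 := by
  refine le_of_forall_lt fun i hi => ?_
  rw [← YoungDiagram.mem_iff_lt_colLen] at hi ⊢
  exact h.1 hi

theorem IsVerticalStrip.length_slackRows_add {lam mu : YoungDiagram}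
    (h : IsVerticalStrip lam mu) :
    (slackRows lam mu).length + (lam.cells \ mu.cells).card = lam.colLen 0 := by
  have h1 : (slackRows lam mu).length =
      ((Finset.range (lam.colLen 0)).filter fun i => lam.rowLen i = mu.rowLen i).card := by
    have : (slackRows lam mu).length =
        ((Finset.range (mu.colLen 0)).filter fun i => lam.rowLen i = mu.rowLen i).card := by
      rw [slackRows, List.length_map]
      rfl
    rw [this]
    congr 1
    ext i
    have h2 := lt_colLen_zero_iff (lam := mu) (i := i)
    have h3 := lt_colLen_zero_iff (lam := lam) (i := i)
    simp only [Finset.mem_filter, Finset.mem_range]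
    omega
  have h2 : (lam.cells \ mu.cells).card =
      ((Finset.range (lam.colLen 0)).filter fun i => ¬ lam.rowLen i = mu.rowLen i).card := by
    refine Finset.card_nbij' Prod.fst (fun i => (i, mu.rowLen i)) ?_ ?_ ?_ ?_
    · rintro ⟨i, j⟩ hij
      have h3 := lt_colLen_zero_iff (lam := lam) (i := i)
      simp only [Finset.mem_coe, Finset.mem_sdiff, YoungDiagram.mem_cells,
        YoungDiagram.mem_iff_lt_rowLen, Finset.mem_filter, Finset.mem_range] at hij ⊢
      omega
    · intro i hi
      have h1 := h.rowLen_le i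
      simp only [Finset.mem_coe, Finset.mem_sdiff, YoungDiagram.mem_cells,
        YoungDiagram.mem_iff_lt_rowLen, Finset.mem_filter, Finset.mem_range] at hi ⊢
      omega
    · rintro ⟨i, j⟩ hij
      have h1 := h.2 i
      simp only [Finset.mem_coe, Finset.mem_sdiff, YoungDiagram.mem_cells,
        YoungDiagram.mem_iff_lt_rowLen] at hij
      simp only [Prod.mk.injEq, true_and]
      omega
    · intro i _
      rfl
  rw [h1, h2, Finset.card_filter_add_card_filter_not, Finset.card_range]

/-! ### The map on a tableau whose iterates stabilize after one step -/

theorem apply_eq_zero_of_mem_recTableaux {n : ℕ} {lam mu : YoungDiagram} {Q : ℕ → ℕ → ℕ}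
    (hQ : Q ∈ recTableaux n lam mu) {i j : ℕ} (h : ¬ ((i, j) ∈ lam ∧ (i, j) ∉ mu)) :
    Q i j = 0 := by
  obtain ⟨R, -, rfl⟩ := hQ
  exact if_neg h

theorem inShape_of_QAII_eq_zero {T : List (List ℕ)} {i j : ℕ} (h : QAII T i j = 0)
    (hT : InShape T i j) (k : ℕ) : InShape (suc^[k] T) i j := by
  classical
  by_contra hk
  have hex : ∃ k, ¬ InShape (suc^[k] T) i j := ⟨k, hk⟩
  rw [QAII, dif_pos hex, Nat.find_eq_zero] at h
  exact h hT

theorem not_inShape_of_QAII_eq_one {T : List (List ℕ)} {i j : ℕ} (h : QAII T i j = 1) :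
    ¬ InShape (suc T) i j := by
  classical
  by_cases hex : ∃ k, ¬ InShape (suc^[k] T) i j
  · rw [QAII, dif_pos hex] at h
    have := Nat.find_spec hex
    rwa [h] at this
  · rw [QAII, dif_neg hex] at h
    exact absurd h zero_ne_one

theorem QAII_eq_one {T : List (List ℕ)} {i j : ℕ} (h : InShape T i j)
    (h' : ¬ InShape (suc T) i j) : QAII T i j = 1 := by
  classical
  have hex : ∃ k, ¬ InShape (suc^[k] T) i j := ⟨1, h'⟩
  rw [QAII, dif_pos hex, Nat.find_eq_iff]
  refine ⟨h', fun m hm => ?_⟩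
  obtain rfl : m = 0 := by omega
  exact not_not.2 h

theorem QAII_eq_zero_of_not_inShape {T : List (List ℕ)} {i j : ℕ} (h : ¬ InShape T i j) :
    QAII T i j = 0 := by
  classical
  have hex : ∃ k, ¬ InShape (suc^[k] T) i j := ⟨0, h⟩
  rw [QAII, dif_pos hex, Nat.find_eq_zero]
  exact h

theorem QAII_eq_zero_of_inShape {T : List (List ℕ)} {i j : ℕ}
    (h : ∀ k, InShape (suc^[k] T) i j) : QAII T i j = 0 := by
  classical
  rw [QAII, dif_neg]
  push Not
  exact h

/-- If all cells outside `mu` are removed in the first step and no others are removed later, then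
the first step already yields the stable value. -/
theorem suc_suc_cols {n : ℕ} {lam mu : YoungDiagram} {Q : ℕ → ℕ → ℕ}
    (hQ : Q ∈ recTableaux n lam mu) (hone : ∀ i j, (i, j) ∈ lam → (i, j) ∉ mu → Q i j = 1)
    {T : SemistandardYoungTableau lam} (hT : QAII (cols T) = Q) :
    suc (suc (cols T)) = suc (cols T) := by
  have hs := suc_semistd (cols_semistd T)
  refine suc_eq_self_of_size hs.1 (size_le_of_inShape fun i j hij => ?_)
  have hlam : (i, j) ∈ lam := inShape_colsOf.1 (hs.2 i j hij)
  have hmem : (i, j) ∈ mu := by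
    by_contra hn
    exact not_inShape_of_QAII_eq_one (by rw [hT, hone i j hlam hn]) hij
  exact inShape_of_QAII_eq_zero (T := cols T)
    (by rw [hT, apply_eq_zero_of_mem_recTableaux hQ fun h => h.2 hmem])
    (inShape_colsOf.2 hlam) 2

/-- The recording tableau is recovered from the shapes of `T` and of `suc T` when the iteration stops
after one step. -/
theorem LRAII_eq {n : ℕ} {lam mu : YoungDiagram} {Q : ℕ → ℕ → ℕ}
    (hQ : Q ∈ recTableaux n lam mu) (hone : ∀ i j, (i, j) ∈ lam → (i, j) ∉ mu → Q i j = 1)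
    {T : SemistandardYoungTableau lam} {S : SemistandardYoungTableau mu}
    (h1 : suc (cols T) = cols S) (h2 : suc (cols S) = cols S) : LRAII T = (cols S, Q) := by
  have h3 : suc (suc (cols T)) = suc (cols T) := by rw [h1, h2]
  rw [LRAII, PAII_eq_suc (cols_semistd T) h3, h1]
  congr 1
  funext i j
  by_cases hl : (i, j) ∈ lam
  · by_cases hm : (i, j) ∈ mu
    · rw [apply_eq_zero_of_mem_recTableaux hQ fun h => h.2 hm]
      refine QAII_eq_zero_of_inShape fun k => ?_
      rcases eq_or_ne k 0 with rfl | hk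
      · exact inShape_colsOf.2 hl
      · rw [iterate_suc h3 hk, h1]
        exact inShape_colsOf.2 hm
    · rw [hone i j hl hm]
      refine QAII_eq_one (inShape_colsOf.2 hl) ?_
      rw [h1]
      exact fun h => hm (inShape_colsOf.1 h)
  · rw [apply_eq_zero_of_mem_recTableaux hQ fun h => hl h.1]
    exact QAII_eq_zero_of_not_inShape fun h => hl (inShape_colsOf.1 h)

/-! ### The preimage -/

theorem exists_isConcat {lam : YoungDiagram} {c : List ℕ} (hc : c.Pairwise (· < ·))
    (hl : c.length = lam.colLen 0) (S : SemistandardYoungTableau (dropCol lam))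
    (hle : ∀ i j, (i, j) ∈ dropCol lam → c.getD i 0 ≤ S i j) :
    ∃ T : SemistandardYoungTableau lam, IsConcat T c S := by
  refine ⟨⟨fun i j => Nat.casesOn j (c.getD i 0) fun j => S i j, ?_, ?_, ?_⟩,
    fun i => rfl, fun i j => rfl⟩
  · intro i j₁ j₂ h hm
    obtain ⟨j, rfl⟩ := Nat.exists_eq_succ_of_ne_zero (Nat.ne_zero_of_lt h)
    rw [Nat.succ_eq_add_one, ← mem_dropCol] at hm
    cases j₁ with
    | zero => exact hle i j hm
    | succ j₁ => exact S.row_weak (by omega) hm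
  · intro i₁ i₂ j h hm
    cases j with
    | zero =>
      have h2 : i₂ < c.length := by
        rw [hl]
        exact YoungDiagram.mem_iff_lt_colLen.1 hm
      have := List.pairwise_iff_getElem.1 hc i₁ i₂ (h.trans h2) h2 h
      simpa [List.getD_eq_getElem, h2, h.trans h2] using this
    | succ j => exact S.col_strict h (mem_dropCol.2 hm)
  · intro i j hm
    cases j with
    | zero =>
      refine List.getD_eq_default _ _ ?_
      rw [hl]
      exact not_lt.1 fun h => hm (YoungDiagram.mem_iff_lt_colLen.2 h)
    | succ j => exact S.zeros fun h => hm (mem_dropCol.1 h)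

theorem IsConcat.map_range {lam : YoungDiagram} {T : SemistandardYoungTableau lam} {c : List ℕ}
    {S : SemistandardYoungTableau (dropCol lam)} (h : IsConcat T c S)
    (hl : c.length = lam.colLen 0) :
    ((List.range (lam.colLen 0)).map fun i => T i 0) = c := by
  rw [← hl]
  refine List.ext_getElem (by simp) fun i h1 h2 => ?_
  simp [h.1, h2]

theorem suc_cols_rowConst {f : ℕ → ℕ} (hf : IsSelector f) (mu : YoungDiagram) :
    suc (cols (rowConst (fun i => f (i + 1)) hf.strictMono mu)) =
      cols (rowConst (fun i => f (i + 1)) hf.strictMono mu) := by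
  have hs := cols_semistd (rowConst (fun i => f (i + 1)) hf.strictMono mu)
  rw [cols_rowConst] at hs ⊢
  by_cases h : mu.rowLen 0 = 0
  · rw [colsOf_eq_nil h]
    rfl
  · rw [colsOf_eq_cons h] at hs ⊢
    refine suc_eq_self_of_red hs ?_
    rw [map_range_succ]
    exact red_map_eq_self hf (fun k hk => (List.mem_range'_1.1 hk).1) List.pairwise_lt_range'

theorem rowConst_mem_SpT {f : ℕ → ℕ} (hf : IsSelector f) {n : ℕ} {mu : YoungDiagram}
    (hmu : mu.colLen 0 ≤ n) : rowConst (fun i => f (i + 1)) hf.strictMono mu ∈ SpT n mu := by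
  have happ : ∀ i j, (i, j) ∈ mu →
      (rowConst (fun i => f (i + 1)) hf.strictMono mu) i j = f (i + 1) :=
    fun i j h => if_pos h
  refine ⟨fun i j h => ?_, fun i h => ?_⟩
  · have h1 := YoungDiagram.mem_iff_lt_colLen.1 (mu.up_left_mem le_rfl (Nat.zero_le j) h)
    have h2 := hf i
    rw [happ i j h]
    omega
  · have h2 := hf i
    rw [happ i 0 h]
    omega

/-- A preimage is determined by its image: the insertion can be undone because the shape is known,
and the first column can be recovered from its reduction because its length is known. -/
theorem eq_of_suc_cols_eq {f : ℕ → ℕ} (hf : IsSelector f) {lam : YoungDiagram} {r c : List ℕ}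
    (hr : (0 :: r).Pairwise (· < ·)) (hc : c.Pairwise (· < ·)) (hpos : ∀ x ∈ c, 1 ≤ x)
    (hl : c.length = lam.colLen 0) (hpat : PairPattern f r c)
    {S : SemistandardYoungTableau (dropCol lam)} {T T' : SemistandardYoungTableau lam}
    (hT : IsConcat T c S) (hT' : ∀ i j, (i, j) ∈ lam → 1 ≤ T' i j)
    (h : suc (cols T') = suc (cols T)) : T' = T := by
  rw [List.pairwise_cons] at hr
  have hr1 : ∀ k ∈ r, 1 ≤ k := fun k hk => hr.1 k hk
  set c' := (List.range (lam.colLen 0)).map fun i => T' i 0 with hc'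
  have hlt : ∀ i ∈ List.range (lam.colLen 0), (i, 0) ∈ lam := fun i hi =>
    YoungDiagram.mem_iff_lt_colLen.2 (List.mem_range.1 hi)
  have hsc' : c'.Pairwise (· < ·) := by
    rw [hc', List.pairwise_map]
    exact List.pairwise_lt_range.imp_of_mem fun {a b} _ hb hab => T'.col_strict hab (hlt b hb)
  have hpos' : ∀ x ∈ c', 1 ≤ x := by
    intro x hx
    obtain ⟨i, hi, rfl⟩ := List.mem_map.1 hx
    exact hT' i 0 (hlt i hi)
  have hsort : ∀ U : SemistandardYoungTableau lam,
      ∀ t ∈ colsOf (dropCol lam) (fun i j => U i (j + 1)), t.Pairwise (· < ·) := fun U =>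
    colsOf_pairwise <| colsOf_semistd
      (fun i j hij => U.row_weak (Nat.lt_succ_self _) (mem_dropCol.1 hij))
      fun i₁ i₂ j hi hij => U.col_strict hi (mem_dropCol.1 hij)
  rw [cols_eq_colsOf, cols_eq_colsOf, suc_colsOf, suc_colsOf, hT.map_range hl, ← hc'] at h
  obtain ⟨h1, h2⟩ := colMul_injective (hsc'.sublist (red_sublist c'))
    (hc.sublist (red_sublist c)) (hsort T') (hsort T)
    (by rw [map_length_colsOf, map_length_colsOf]) h
  rw [hpat.red_eq hf hr1 hr.2 hc hpos] at h1
  have hcc : c' = c := (pairPattern_of_red_eq hf hr1 hsc' hpos' h1).eq_of_length_eq hf hpos' hpos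
    hsc' hc hpat (by rw [hc', hl]; simp)
  refine SemistandardYoungTableau.ext fun i j => ?_
  by_cases hij : (i, j) ∈ lam
  · cases j with
    | zero =>
      rw [hT.1 i, ← hcc, hc', getD_map_range (YoungDiagram.mem_iff_lt_colLen.1 hij)]
    | succ j => exact eq_of_colsOf_eq h2 (mem_dropCol.2 hij)
  · rw [T'.zeros hij, T.zeros hij]

/-- Both halves of the theorem, for an arbitrary selector of one element of each pair. -/
theorem fiber_rowConst {f : ℕ → ℕ} (hf : IsSelector f) {n : ℕ} {lam mu : YoungDiagram}
    (hmu : mu.colLen 0 ≤ n) (hstrip : IsVerticalStrip lam mu) {Q : ℕ → ℕ → ℕ}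
    (hQ : Q ∈ recTableaux n lam mu) (hone : ∀ i j, (i, j) ∈ lam → (i, j) ∉ mu → Q i j = 1)
    {l : ℕ} (hl : l = lam.colLen 0) {r : List ℕ} (hr : r = slackRows lam mu)
    {a L : List ℕ} (ha : a = r.map f) (hL : L = fill (gaps a) (l - r.length)) :
    rowConst (fun i => f (i + 1)) hf.strictMono mu ∈ SpT n mu ∧
    rowConst (fun i => f (i + 1)) hf.strictMono (dropCol lam) ∈ SpT n (dropCol lam) ∧
    (∀ m ∈ L, Even m) ∧ L.sum + r.length = l ∧
    ((gaps a).sum + r.length ≤ l → L = gaps a ++ [l - r.length - (gaps a).sum]) ∧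
    IsColumn (2 * n) l (expandCol a L) ∧
    ∃ T : SemistandardYoungTableau lam,
      IsConcat T (expandCol a L) (rowConst (fun i => f (i + 1)) hf.strictMono (dropCol lam)) ∧
      LRAIIFiber n lam (rowConst (fun i => f (i + 1)) hf.strictMono mu) Q = {T} ∧
      T ∈ SST (2 * n) lam ∧
      PAII (cols T) = cols (rowConst (fun i => f (i + 1)) hf.strictMono mu) ∧
      ∀ i, (content T (f (i + 1)) : ℤ) - content T (4 * i + 3 - f (i + 1)) = mu.rowLen i := by
  have hcard := card_strip hmu hQ
  have hlen := hstrip.length_slackRows_add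
  have hrow := hstrip.rowLen_dropCol_add
  have hsr := slackRows_pairwise lam mu
  have hrle : ∀ k ∈ slackRows lam mu, k ≤ mu.colLen 0 := by
    intro k hk
    obtain ⟨i, rfl⟩ := Nat.exists_eq_add_of_le' ((List.pairwise_cons.1 hsr).1 k hk)
    exact (mem_slackRows.1 hk).1
  rw [← hr] at hlen hrow hsr hrle
  rw [← hl] at hcard hlen
  clear hr
  obtain ⟨q, hq⟩ := hcard.1
  have hq' : l - r.length = 2 * q := by omega
  have hmul := hstrip.colLen_le
  have hmu' : (dropCol lam).colLen 0 ≤ mu.colLen 0 := by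
    refine le_of_forall_lt fun i hi => ?_
    have := hrow i
    rw [lt_colLen_zero_iff] at hi ⊢
    omega
  have hexp : expandCol a L = pairFill f 0 r q := by
    rw [hL, hq', ha, expandCol_eq_pairFill hf hsr]
  have hcs : (pairFill f 0 r q).Pairwise (· < ·) := pairwise_pairFill hf hsr
  have hcl : (pairFill f 0 r q).length = lam.colLen 0 := by
    rw [length_pairFill]
    omega
  have hpos : ∀ x ∈ pairFill f 0 r q, 1 ≤ x := fun x hx => le_of_mem_pairFill hf hsr hx
  have hle : ∀ x ∈ pairFill f 0 r q, x ≤ 2 * n := fun x hx =>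
    mem_pairFill_le hf hsr (fun k hk => (hrle k hk).trans hmu) (by omega) hx
  have hpat := pairPattern_pairFill hf hsr q
  have hSp := rowConst_mem_SpT hf hmu
  have hSp' := rowConst_mem_SpT hf (hmu'.trans hmu)
  obtain ⟨T, hT⟩ := exists_isConcat hcs hcl
    (rowConst (fun i => f (i + 1)) hf.strictMono (dropCol lam)) fun i j hij => by
      have h1 : (i, 0) ∈ dropCol lam := (dropCol lam).up_left_mem le_rfl (Nat.zero_le j) hij
      rw [YoungDiagram.mem_iff_lt_colLen] at h1
      have h2 : (rowConst (fun i => f (i + 1)) hf.strictMono (dropCol lam)) i j = f (i + 1) :=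
        if_pos hij
      have h3 := getD_pairFill_le hf (q := q) (e := 0) (i := i) hsr hrle (by omega) (by omega)
      rw [h2]
      simpa using h3
  have hsuc : suc (cols T) = cols (rowConst (fun i => f (i + 1)) hf.strictMono mu) := by
    have hS : colsOf (dropCol lam) (fun i j => T i (j + 1)) =
        colsOf (dropCol lam) fun i _ => f (i + 1) :=
      colsOf_congr fun i j hij => by
        rw [hT.2 i j]
        exact if_pos hij
    rw [cols_eq_colsOf, suc_colsOf, hT.map_range hcl, cols_rowConst, hS,
      hpat.red_eq hf (fun k hk => (List.pairwise_cons.1 hsr).1 k hk) (List.pairwise_cons.1 hsr).2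
        hcs hpos]
    exact colMul_map_colsOf hf hsr hrow
  have hLR := LRAII_eq hQ hone hsuc (suc_cols_rowConst hf mu)
  have hSST : T ∈ SST (2 * n) lam := by
    intro i j hij
    cases j with
    | zero =>
      have h1 : i < (pairFill f 0 r q).length := by
        rw [hcl]
        exact YoungDiagram.mem_iff_lt_colLen.1 hij
      have h2 : T i 0 ∈ pairFill f 0 r q := by
        rw [hT.1 i, List.getD_eq_getElem _ _ h1]
        exact List.getElem_mem h1
      exact ⟨hpos _ h2, hle _ h2⟩
    | succ j =>
      rw [hT.2 i j]
      exact hSp'.1 i j (mem_dropCol.2 hij)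
  refine ⟨hSp, hSp', fun m hm => ?_, ?_, fun h => ?_, ?_, T, ?_, ?_, hSST, ?_, fun i => ?_⟩
  · rw [hL, ha] at hm
    exact even_of_mem_fill (fun x hx => hf.even_of_mem_gaps hsr hx) (hq' ▸ even_two_mul q) hm
  · rw [hL, sum_fill]
    omega
  · rw [hL, fill_of_sum_le (by omega)]
  · rw [hexp]
    exact ⟨hcl.trans hl.symm, hcs, fun x hx => ⟨hpos x hx, hle x hx⟩⟩
  · rw [hexp]
    exact hT
  · refine Set.Subset.antisymm (fun T' hT' => ?_) (Set.singleton_subset_iff.2 ⟨hSST, hLR⟩)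
    obtain ⟨h1, h2⟩ := hT'
    have h3 := Prod.mk.inj h2
    have h4 := suc_suc_cols hQ hone h3.2
    have h5 : suc (cols T') = suc (cols T) := by
      rw [hsuc, ← PAII_eq_suc (cols_semistd T') h4]
      exact h3.1
    exact eq_of_suc_cols_eq hf hsr hcs hpos hcl hpat hT (fun i j hij => (h1 i j hij).1) h5
  · exact (Prod.mk.inj hLR).1
  · have hfi := hf i
    have hne : ∀ j, f (j + 1) ≠ 4 * i + 3 - f (i + 1) := fun j hj => by
      have h1 := hf j
      have h2 : j = i := by omega
      subst h2
      omega
    have hnd : (pairFill f 0 r q).Nodup := hcs.imp fun h => h.ne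
    rw [content_of_isConcat hT hcl, content_of_isConcat hT hcl, content_rowConst hf,
      content_rowConst_eq_zero hf (dropCol lam) hne, hnd.count, hnd.count, ← hrow i]
    by_cases hir : i + 1 ∈ r
    · obtain ⟨h1, h2⟩ := hpat.mem i hir
      have h3 : 4 * i + 3 - f (i + 1) ∉ pairFill f 0 r q := by
        intro h3
        rcases hfi with e | e <;> rw [e] at h1 h3
        · exact h2 ⟨h1, by rwa [show 4 * i + 3 - (2 * i + 1) = 2 * i + 2 by omega] at h3⟩
        · exact h2 ⟨by rwa [show 4 * i + 3 - (2 * i + 2) = 2 * i + 1 by omega] at h3, h1⟩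
      rw [if_pos h1, if_neg h3, if_pos hir]
      push_cast
      ring
    · have h1 : f (i + 1) ∈ pairFill f 0 r q ↔ 4 * i + 3 - f (i + 1) ∈ pairFill f 0 r q := by
        have h2 := hpat.iff i hir
        rcases hfi with e | e <;> rw [e]
        · rwa [show 4 * i + 3 - (2 * i + 1) = 2 * i + 2 by omega]
        · rw [show 4 * i + 3 - (2 * i + 2) = 2 * i + 1 by omega]
          exact h2.symm
      simp only [h1, if_neg hir]
      push_cast
      ring

theorem isSelector_u : IsSelector u := by
  intro i
  simp only [u]
  split_ifs <;> omega

theorem isSelector_v : IsSelector v := by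
  intro i
  simp only [v]
  split_ifs <;> omega

theorem u_add_v (i : ℕ) : u (i + 1) + v (i + 1) = 4 * i + 3 := by
  simp only [u, v, ← Nat.not_even_iff_odd]
  split_ifs <;> omega

end AII

theorem mainTheorem3 (n : ℕ) (lam mu : YoungDiagram)
    (hlam : lam.colLen 0 ≤ 2 * n) (hmu : mu.colLen 0 ≤ n)
    (hstrip : AII.IsVerticalStrip lam mu)
    (Q : ℕ → ℕ → ℕ) (hQ : Q ∈ AII.recTableaux n lam mu)
    (hone : ∀ i j, (i, j) ∈ lam → (i, j) ∉ mu → Q i j = 1)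
    (l : ℕ) (hl : l = lam.colLen 0)
    (r : List ℕ) (hr : r = AII.slackRows lam mu)
    (ur vr : List ℕ) (hur : ur = r.map AII.u) (hvr : vr = r.map AII.v)
    (Lu Lv : List ℕ) (hLu : Lu = AII.fill (AII.gaps ur) (l - r.length))
    (hLv : Lv = AII.fill (AII.gaps vr) (l - r.length)) :
    ∃ mu' : YoungDiagram,
      (∀ i, mu'.rowLen i + (if i + 1 ∈ r then 1 else 0) = mu.rowLen i) ∧
      (∀ i, lam.rowLen i = mu'.rowLen i + (if i < l then 1 else 0)) ∧
      -- the highest weight tableau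
      (AII.SHigh mu ∈ AII.SpT n mu ∧ AII.SHigh mu' ∈ AII.SpT n mu' ∧
        (∀ m ∈ Lu, Even m) ∧ Lu.sum + r.length = l ∧
        ((AII.gaps ur).sum + r.length ≤ l →
          Lu = AII.gaps ur ++ [l - r.length - (AII.gaps ur).sum]) ∧
        AII.IsColumn (2 * n) l (AII.expandCol ur Lu) ∧
        ∃ T : SemistandardYoungTableau lam,
          AII.IsConcat T (AII.expandCol ur Lu) (AII.SHigh mu') ∧
          AII.LRAIIFiber n lam (AII.SHigh mu) Q = {T} ∧
          T ∈ AII.SST (2 * n) lam ∧ AII.IsKHighest n T ∧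
          ∀ k : Fin n, AII.kWeight n T k = (mu.rowLen k : ℤ)) ∧
      -- the lowest weight tableau
      (AII.SLow mu ∈ AII.SpT n mu ∧ AII.SLow mu' ∈ AII.SpT n mu' ∧
        (∀ m ∈ Lv, Even m) ∧ Lv.sum + r.length = l ∧
        ((AII.gaps vr).sum + r.length ≤ l →
          Lv = AII.gaps vr ++ [l - r.length - (AII.gaps vr).sum]) ∧
        AII.IsColumn (2 * n) l (AII.expandCol vr Lv) ∧
        ∃ T : SemistandardYoungTableau lam,
          AII.IsConcat T (AII.expandCol vr Lv) (AII.SLow mu') ∧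
          AII.LRAIIFiber n lam (AII.SLow mu) Q = {T} ∧
          T ∈ AII.SST (2 * n) lam ∧ AII.IsKLowest n T ∧
          ∀ k : Fin n, AII.kWeight n T k = -(mu.rowLen k : ℤ)) := by
  obtain ⟨h1, h2, h3, h4, h5, h6, T, h7, h8, h9, h10, h11⟩ :=
    AII.fiber_rowConst AII.isSelector_u hmu hstrip hQ hone hl hr hur hLu
  obtain ⟨k1, k2, k3, k4, k5, k6, U, k7, k8, k9, k10, k11⟩ :=
    AII.fiber_rowConst AII.isSelector_v hmu hstrip hQ hone hl hr hvr hLv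
  refine ⟨AII.dropCol lam, fun i => ?_, fun i => ?_,
    ⟨h1, h2, h3, h4, h5, h6, T, h7, h8, h9, ⟨mu, hmu, h10⟩, fun k => ?_⟩,
    ⟨k1, k2, k3, k4, k5, k6, U, k7, k8, k9, ⟨mu, hmu, k10⟩, fun k => ?_⟩⟩
  · rw [hr]
    exact hstrip.rowLen_dropCol_add i
  · rw [hl]
    exact AII.rowLen_eq_dropCol_add lam i
  · rw [← h11 k, ← AII.u_add_v, Nat.add_sub_cancel_left]
    rfl
  · rw [← k11 k, ← AII.u_add_v, Nat.add_sub_cancel, neg_sub]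
    rfl
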